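/- Let $N,n\ge 0$ be integers and let $\mathcal W_n$ be the set of words of length $n$ without repeated letter in the alphabet $\{1,\dots,N\}$. **D$_0$ graphs.** A D$_0$ graph of degree $n$ is a graph on a vertex set $W\subseteq\mathcal W_n$ with edges colored from $\{2,\dots,n-1\}$ such that, for every $i$: (i) each $i$-edge is one of the pairs $\{v\,bac\,w,\;v\,bca\,w\}$, $\{v\,acb\,w,\;v\,cab\,w\}$, $\{v\,bac\,w,\;v\,acb\,w\}$, $\{v\,bca\,w,\;v\,cab\,w\}$ for some letters $a<b<c$ and words $v,w$ with $|v|=i-2$; (ii) for all letters $a<b<c$ and words $v,w$ with $|v|=i-2$, each element of $W\cap\{v\,bac\,w,\;v\,bca\,w,\;v\,acb\,w,\;v\,cab\,w\}$ belongs to exactly one $i$-edge. **Signed, colored graphs.** A signed, colored graph of degree $n$ is a finite graph $\mathcal G$ with vertex set $V$ and edges colored from $\{2,\dots,n-1\}$ (for each color a simple graph), together with a signature $\sigma:V\to\{+1,-1\}^{n-1}$. A D$_0$ graph is regarded as one by $\sigma(w)_i=+1$ if $w_i\le w_{i+1}$ and $\sigma(w)_i=-1$ if $w_i>w_{i+1}$.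 A vertex $v$ admits an $i$-neighbor if it is on some $i$-edge; if $v$ is on exactly one $i$-edge $\{v,w\}$, write $E_i(v)=w$. For an interval $K=\{a,\dots,a+d-1\}\subseteq\{1,\dots,n\}$, the restriction $\mathrm{Res}_K\mathcal G$ is the signed, colored graph of degree $d$ on the same vertices whose $s$-edges are the $(s+a-1)$-edges of $\mathcal G$ ($2\le s\le d-1$) and whose signature is $(\sigma(v)_a,\dots,\sigma(v)_{a+d-2})$; $\mathrm{Res}_K(\mathcal G,w)$ is its connected component containing $w$. The generating function of (a component of) a signed, colored graph of degree $n$ is the sum over its vertices $v$ of Gessel's fundamental quasisymmetric function $$Q_{\mathrm{Des}(v)}(\mathbf x)=\sum_{\substack{1\le i_1\le\cdots\le i_n\\ j\in\mathrm{Des}(v)\Rightarrow i_j<i_{j+1}}}x_{i_1}\cdots x_{i_n},\qquad \mathrm{Des}(v)=\{j:\sigma(v)_j=-1\}.$$ $\mathcal G$ is locally Schur positive for degree $d$ ($\mathrm{LSP}_d$) if for every interval $K\subseteq\{1,\dots,n\}$ of size $d$ the generating function of each connected component of $\mathrm{Res}_K\mathcal G$ is a nonnegative integer combination of Schur functions.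 **Axioms.** Conditions that involve a coordinate of $\sigma$ outside $\{1,\dots,n-1\}$ are void. * Axiom 1: every vertex is on at most one $i$-edge for each $i$ (axiom 0), and for $2\le i\le n-1$ a vertex $w$ admits an $i$-neighbor if and only if $\sigma(w)_{i-1}=-\sigma(w)_i$. * Axiom 2: for each $i$-edge $\{w,x\}$, $\sigma(w)_j=-\sigma(x)_j$ for $j=i-1,i$, and $\sigma(w)_h=\sigma(x)_h$ for $h<i-2$ and for $h>i+1$. * Axiom 3: for each $i$-edge $\{w,x\}$, if $\sigma(w)_{i-2}=-\sigma(x)_{i-2}$ then $\sigma(w)_{i-2}=-\sigma(w)_{i-1}$, and if $\sigma(w)_{i+1}=-\sigma(x)_{i+1}$ then $\sigma(w)_{i+1}=-\sigma(w)_i$. * Axiom 4'a: for $4\le i\le n-1$, if $\{w,v\}$ is an $(i-1)$-edge and not an $i$-edge, $\sigma(w)_{i-3}\ne\sigma(v)_{i-3}$ and $\sigma(w)_i\ne\sigma(v)_i$, then $\mathrm{Res}_{[i-3,i]}(\mathcal G,w)$ and $\mathrm{Res}_{[i-2,i+1]}(\mathcal G,w)$ have the same generating function. * Axiom 4'b (for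 graphs that satisfy axiom 0): say that $v$ has $i$-type W if $v$ admits an $i$-neighbor and an $(i-1)$-neighbor and $\sigma(v)_i=-\sigma(E_{i-1}(v))_i$. For $4\le i<n$, a flat $i$-chain is a sequence $(x^1,\dots,x^{2h})$ of distinct vertices admitting $(i-2)$-neighbors such that $x^{2j-1}=E_i(x^{2j})$ for $1\le j\le h$ and, for $1\le j<h$, $x^{2j+1}=E_{i-2}(E_{i-1}E_{i-2})^{m_j}(x^{2j})$ for some integer $m_j\ge0$ such that $(E_{i-1}E_{i-2})^{m_j}(x^{2j})$ does not have $(i-1)$-type W (all the $E$'s being defined where they are applied). The axiom says: if $(x^1,\dots,x^{2h})$ is a flat $i$-chain and $x^j$ has $(i+1)$-type W for some $2<j<2h-1$, then $x^1,\dots,x^j$ all have $(i+1)$-type W or $x^j,\dots,x^{2h}$ all have $(i+1)$-type W. * Axiom 5: if $\{w,x\}$ is an $i$-edge and $\{x,y\}$ is a $j$-edge with $|i-j|\ge3$, then there is a vertex $v$ such that $\{w,v\}$ is a $j$-edge and $\{v,y\}$ is an $i$-edge. A D graph is a signed, colored graph that satisfies axioms 1, 2, 3, 4'a, 4'b, 5,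 $\mathrm{LSP}_4$ and $\mathrm{LSP}_5$. **Theorem.** Every D$_0$ graph satisfies axioms 1, 2, 3, 4'a, $\mathrm{LSP}_4$ and $\mathrm{LSP}_5$. Hence a D$_0$ graph is a D graph if and only if it satisfies axioms 4'b and 5. -/

import Mathlib

/-! ## Quasisymmetric functions, Schur functions, Schur positivity

Formal power series with integer coefficients in the variables `x_0, x_1, x_2, …`. -/

/-- Gessel's fundamental quasisymmetric function of degree `n`: the sum of the monomials
`x_{f 0} ⋯ x_{f (n-1)}` over all weakly increasing sequences `f` of length `n` that increase
strictly at each descent. The element `s` of `D` stands for the descent between the positions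
`s` and `s + 1` counted from `0`, i.e. for the descent `s + 1 ∈ {1, …, n - 1}`. -/
noncomputable def fundamentalQSym (n : ℕ) (D : Set (Fin (n - 1))) : MvPowerSeries ℕ ℤ :=
  fun m => (Nat.card {f : Fin n → ℕ //
    Monotone f ∧
    (∀ s : Fin (n - 1), s ∈ D → f ⟨s, by omega⟩ < f ⟨s + 1, by omega⟩) ∧
    ∑ k, Finsupp.single (f k) 1 = m} : ℤ)

/-- The Schur function `s_μ`: the sum over all semistandard Young tableaux of shape `μ`
of the monomial that records the entries. -/
noncomputable def schurFunction (μ : YoungDiagram) : MvPowerSeries ℕ ℤ :=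
  fun m => (Nat.card {T : SemistandardYoungTableau μ //
    ∑ c ∈ μ.cells, Finsupp.single (T c.1 c.2) 1 = m} : ℤ)

/-- A power series is Schur positive if it is a finite linear combination of Schur functions
with nonnegative integer coefficients. -/
def SchurPositive (F : MvPowerSeries ℕ ℤ) : Prop :=
  ∃ c : YoungDiagram →₀ ℕ, F = c.sum fun μ k => k • schurFunction μ

/-! ## Signed, colored graphs -/

/-- A signed, colored graph of degree `n` on the vertex set `V`: a graph whose edges are colored
from `{2, …, n - 1}` (one simple graph per color), with a signature `V → {+1, -1}^{n-1}`. -/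
structure SignedColoredGraph (n : ℕ) (V : Type*) where
  /-- `(edge i).Adj v w` says that `{v, w}` is an `i`-edge. -/
  edge : ℕ → SimpleGraph V
  color_mem : ∀ i v w, (edge i).Adj v w → 2 ≤ i ∧ i < n
  /-- The signature; the entry with index `s : Fin (n - 1)` is the coordinate `s + 1`. -/
  signature : V → Fin (n - 1) → ℤˣ

namespace SignedColoredGraph

variable {n : ℕ} {V : Type*}

/-- `G.sgn v i` is the `i`-th coordinate of the signature of `v`, for `1 ≤ i ≤ n - 1`.
(The value for other `i` is a placeholder which is never used below.) -/
def sgn (G : SignedColoredGraph n V) (v : V) (i : ℕ) : ℤˣ :=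
  if h : 1 ≤ i ∧ i < n then G.signature v ⟨i - 1, by omega⟩ else 1

/-- `v` admits an `i`-neighbor. -/
def AdmitsNeighbor (G : SignedColoredGraph n V) (i : ℕ) (v : V) : Prop :=
  ∃ w, (G.edge i).Adj v w

/-- The underlying graph, colors forgotten. -/
def graph (G : SignedColoredGraph n V) : SimpleGraph V := ⨆ i, G.edge i

/-- The restriction `Res_K G` to the interval `K = {a, a + 1, …, a + d - 1}`, a signed, colored
graph of degree `d` on the same vertices: its `s`-edges are the `(s + a - 1)`-edges of `G`, for
`2 ≤ s ≤ d - 1`, and the coordinates of its signature are the coordinates `a, …, a + d - 2` of the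
signature of `G`. (It is used only if `K` is contained in `{1, …, n}`.) -/
def res (G : SignedColoredGraph n V) (a d : ℕ) : SignedColoredGraph d V where
  edge s := if 2 ≤ s ∧ s < d then G.edge (s + a - 1) else ⊥
  color_mem s v w h := by
    by_contra hs
    rw [if_neg hs] at h
    exact h
  signature v s := G.sgn v (s + a)

/-- The descent set encoded by the signature of `v`. -/
def descents (G : SignedColoredGraph n V) (v : V) : Set (Fin (n - 1)) :=
  {s | G.signature v s = -1}

open Classical in
/-- The generating function of the connected component `C` of `G`. -/
noncomputable def componentGenFun [Fintype V] (G : SignedColoredGraph n V)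
    (C : G.graph.ConnectedComponent) : MvPowerSeries ℕ ℤ :=
  ∑ v : V with G.graph.connectedComponentMk v = C, fundamentalQSym n (G.descents v)

/-- Local Schur positivity for degree `d`: the generating function of each component of each
restriction to an interval of size `d` contained in `{1, …, n}` is Schur positive. -/
def LSP [Fintype V] (d : ℕ) (G : SignedColoredGraph n V) : Prop :=
  ∀ a, 1 ≤ a → a + d ≤ n + 1 →
    ∀ C : (G.res a d).graph.ConnectedComponent, SchurPositive ((G.res a d).componentGenFun C)

/-- Axiom 0: each vertex has at most one `i`-neighbor. -/
def Axiom0 (G : SignedColoredGraph n V) : Prop :=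
  ∀ i v w w', (G.edge i).Adj v w → (G.edge i).Adj v w' → w = w'

def Axiom1 (G : SignedColoredGraph n V) : Prop :=
  G.Axiom0 ∧ ∀ i w, 2 ≤ i → i < n → (G.AdmitsNeighbor i w ↔ G.sgn w (i - 1) = -G.sgn w i)

def Axiom2 (G : SignedColoredGraph n V) : Prop :=
  ∀ i w x, (G.edge i).Adj w x →
    G.sgn w (i - 1) = -G.sgn x (i - 1) ∧ G.sgn w i = -G.sgn x i ∧
    ∀ h, 1 ≤ h → h < n → (h + 2 < i ∨ i + 1 < h) → G.sgn w h = G.sgn x h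

/-- Axiom 3. The first condition is void if the coordinate `i - 2` does not exist (`i = 2`),
the second one if the coordinate `i + 1` does not exist (`i = n - 1`). -/
def Axiom3 (G : SignedColoredGraph n V) : Prop :=
  ∀ i w x, (G.edge i).Adj w x →
    (3 ≤ i → G.sgn w (i - 2) = -G.sgn x (i - 2) → G.sgn w (i - 2) = -G.sgn w (i - 1)) ∧
    (i + 1 < n → G.sgn w (i + 1) = -G.sgn x (i + 1) → G.sgn w (i + 1) = -G.sgn w i)

/-- Axiom 4'a. The two intervals `[i - 3, i]` and `[i - 2, i + 1]` have size 4, and both lie in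
`{1, …, n}` exactly if `4 ≤ i < n`. -/
def Axiom4a [Fintype V] (G : SignedColoredGraph n V) : Prop :=
  ∀ i w v, 4 ≤ i → i < n → (G.edge (i - 1)).Adj w v → ¬ (G.edge i).Adj w v →
    G.sgn w (i - 3) ≠ G.sgn v (i - 3) → G.sgn w i ≠ G.sgn v i →
    (G.res (i - 3) 4).componentGenFun ((G.res (i - 3) 4).graph.connectedComponentMk w) =
    (G.res (i - 2) 4).componentGenFun ((G.res (i - 2) 4).graph.connectedComponentMk w)

/-- `v` has `i`-type W (in a graph that satisfies axiom 0). -/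
def HasTypeW (G : SignedColoredGraph n V) (i : ℕ) (v : V) : Prop :=
  G.AdmitsNeighbor i v ∧ ∃ u, (G.edge (i - 1)).Adj v u ∧ G.sgn v i = -G.sgn u i

/-- `x 1, …, x (2 * h)` is a flat `i`-chain (in a graph that satisfies axiom 0, so that the edges
of one color are a partial involution `E`). The relation under `ReflTransGen` is
`z' = E_{i-1} (E_{i-2} z)`. -/
def IsFlatChain (G : SignedColoredGraph n V) (i h : ℕ) (x : ℕ → V) : Prop :=
  4 ≤ i ∧ i < n ∧
  Set.InjOn x (Set.Icc 1 (2 * h)) ∧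
  (∀ k, 1 ≤ k → k ≤ 2 * h → G.AdmitsNeighbor (i - 2) (x k)) ∧
  (∀ j, 1 ≤ j → j ≤ h → (G.edge i).Adj (x (2 * j - 1)) (x (2 * j))) ∧
  (∀ j, 1 ≤ j → j < h → ∃ z,
    Relation.ReflTransGen
      (fun z z' => ∃ u, (G.edge (i - 2)).Adj z u ∧ (G.edge (i - 1)).Adj u z') (x (2 * j)) z ∧
    ¬ G.HasTypeW (i - 1) z ∧
    (G.edge (i - 2)).Adj z (x (2 * j + 1)))

/-- Axiom 4'b. -/
def Axiom4b (G : SignedColoredGraph n V) : Prop :=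
  ∀ i h x, G.IsFlatChain i h x → ∀ j, 2 < j → j < 2 * h - 1 → G.HasTypeW (i + 1) (x j) →
    (∀ k, 1 ≤ k → k ≤ j → G.HasTypeW (i + 1) (x k)) ∨
    (∀ k, j ≤ k → k ≤ 2 * h → G.HasTypeW (i + 1) (x k))

def Axiom5 (G : SignedColoredGraph n V) : Prop :=
  ∀ i j w x y, (i + 3 ≤ j ∨ j + 3 ≤ i) → (G.edge i).Adj w x → (G.edge j).Adj x y →
    ∃ v, (G.edge j).Adj w v ∧ (G.edge i).Adj v y

/-- D graphs in the sense of Assaf. -/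
def IsDGraph [Fintype V] (G : SignedColoredGraph n V) : Prop :=
  G.Axiom1 ∧ G.Axiom2 ∧ G.Axiom3 ∧ G.Axiom4a ∧ G.Axiom4b ∧ G.Axiom5 ∧ G.LSP 4 ∧ G.LSP 5

end SignedColoredGraph

/-! ## D₀ graphs

Words in the alphabet of `N` letters are lists over `Fin N`. -/

/-- `{x, y}` is one of the two pairs `{v bac w, v bca w}`, `{v acb w, v cab w}` with letters
`a < b < c` and `|v| = i - 2`. -/
def IsKnuthPair {N : ℕ} (i : ℕ) (x y : List (Fin N)) : Prop :=
  ∃ (v w : List (Fin N)) (a b c : Fin N), a < b ∧ b < c ∧ v.length + 2 = i ∧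
    (({x, y} : Set (List (Fin N))) = {v ++ [b, a, c] ++ w, v ++ [b, c, a] ++ w} ∨
     ({x, y} : Set (List (Fin N))) = {v ++ [a, c, b] ++ w, v ++ [c, a, b] ++ w})

/-- `{x, y}` is one of the two pairs `{v bac w, v acb w}`, `{v bca w, v cab w}` with letters
`a < b < c` and `|v| = i - 2`. -/
def IsRotationPair {N : ℕ} (i : ℕ) (x y : List (Fin N)) : Prop :=
  ∃ (v w : List (Fin N)) (a b c : Fin N), a < b ∧ b < c ∧ v.length + 2 = i ∧
    (({x, y} : Set (List (Fin N))) = {v ++ [b, a, c] ++ w, v ++ [a, c, b] ++ w} ∨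
     ({x, y} : Set (List (Fin N))) = {v ++ [b, c, a] ++ w, v ++ [c, a, b] ++ w})

/-- A D₀ graph of degree `n` (alphabet of `N` letters): a graph on a set `verts` of words of
length `n` without repeated letter, with edges colored from `{2, …, n - 1}`, such that each
`i`-edge is a Knuth pair or a rotation pair at the positions `i - 1, i, i + 1`, and each vertex
in a square `{v bac w, v bca w, v acb w, v cab w}` with `|v| = i - 2` is on exactly one
`i`-edge. -/
structure D0Graph (N n : ℕ) where
  verts : Finset (List (Fin N))
  length_eq : ∀ x ∈ verts, x.length = n
  nodup : ∀ x ∈ verts, x.Nodup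
  edge : ℕ → SimpleGraph verts
  color_mem : ∀ i x y, (edge i).Adj x y → 2 ≤ i ∧ i < n
  isPair : ∀ i (x y : verts), (edge i).Adj x y →
    IsKnuthPair i (x : List (Fin N)) y ∨ IsRotationPair i (x : List (Fin N)) y
  existsUnique_edge : ∀ (i : ℕ) (v w : List (Fin N)) (a b c : Fin N),
    a < b → b < c → v.length + 2 = i →
    ∀ x : verts, (x : List (Fin N)) ∈ ({v ++ [b, a, c] ++ w, v ++ [b, c, a] ++ w,
      v ++ [a, c, b] ++ w, v ++ [c, a, b] ++ w} : Set (List (Fin N))) →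
    ∃! y, (edge i).Adj x y

/-- A D₀ graph as a signed, colored graph: the `i`-th sign of a word is `-1` if the word has a
descent at `i`, and `+1` otherwise. -/
def D0Graph.toSignedColoredGraph {N n : ℕ} (G : D0Graph N n) :
    SignedColoredGraph n G.verts where
  edge := G.edge
  color_mem := G.color_mem
  signature x s :=
    if x.1[(s : ℕ)]'(by rw [G.length_eq x.1 x.2]; omega) ≤
        x.1[(s : ℕ) + 1]'(by rw [G.length_eq x.1 x.2]; omega)
    then 1 else -1

/-! Axioms 1, 2 and 3 are read off the three letters in the window of an `i`-edge. A word lies in a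
square exactly when these letters are not monotone. Every allowed pair joins a word whose descent
comes first (`bac`, `cab`) to a word whose descent comes second (`bca`, `acb`), and both outer
letters weakly decrease in this direction.

Local Schur positivity: a component of a restriction to an interval of size `d` only rearranges `d`
letters, so it is the indicator `g` of a set of permutations. In each square the edges match the
vertices of the first kind with those of the second, hence `g(bac) + g(cab) = g(bca) + g(acb)`,
whichever pairs the graph uses (`square_count`, `exists_componentGenFun_eq`). For `d = 4, 5` these
linear equations force the sums of `g` over descent classes to be the coefficients of a Schur
expansion, and each multiplicity is itself a sum of values of `g`, hence nonnegative
(`IsBalanced.descentClassSum_4`, `IsBalanced.descentClassSum_5`). The comparison rests on the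
expansion of a Schur function over standard tableaux (`schurFunction_eq_sum`).

Axiom 4'a: a Knuth pair keeps the first or the last letter of the window, so only a rotation pair
changes both neighboring signs. Up to reversal of the order, the pair is then `p bac q`, `p acb q`
with `a < p < b < q < c`. Whatever the other edges are, both components are paths with five vertices
and the same sequence of signatures (`componentGenFun_eq_of_rotation`). -/

/-! ## Schur functions as sums of fundamental quasisymmetric functions -/

/-- `e` lists the cells of `μ` along a linear extension, i.e. it is a standard Young tableau. -/
def IsLinearExtension (μ : YoungDiagram) {n : ℕ} (e : Fin n → ℕ × ℕ) : Prop :=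
  Function.Injective e ∧ (∀ c, c ∈ μ ↔ c ∈ Set.range e) ∧ ∀ i j, e i ≤ e j → i ≤ j

/-- The positions `s` such that the cell `e (s + 1)` is not in a column to the right
of the column of `e s`. -/
def columnDescents {n : ℕ} (e : Fin n → ℕ × ℕ) : Set (Fin (n - 1)) :=
  {s | (e ⟨s + 1, by omega⟩).2 ≤ (e ⟨s, by omega⟩).2}

/-- Equal values are forced into strictly increasing columns. Hence `e` can be recovered from the
tableau by sorting the cells by value and, among equal values, from left to right. -/
theorem strictMono_lex_column {n : ℕ} {e : Fin n → ℕ × ℕ} {f : Fin n → ℕ} (hf : Monotone f)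
    (hd : ∀ s : Fin (n - 1), s ∈ columnDescents e →
      f ⟨s, by omega⟩ < f ⟨s + 1, by omega⟩) :
    StrictMono fun k => toLex (f k, (e k).2) := by
  rcases n with _ | n
  · intro a; exact a.elim0
  · rw [Fin.strictMono_iff_lt_succ]
    intro i
    rw [Prod.Lex.toLex_lt_toLex]
    rcases (hf (Fin.castSucc_le_succ i)).lt_or_eq with h | h
    · exact Or.inl h
    · refine Or.inr ⟨h, ?_⟩
      by_contra hlt
      exact absurd (hd i (not_lt.mp hlt)) (by simpa using! h.symm.le)

namespace SemistandardYoungTableau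

theorem le_of_cell_le {μ : YoungDiagram} (T : SemistandardYoungTableau μ) {c d : ℕ × ℕ}
    (h : c ≤ d) (hd : d ∈ μ) : T c.1 c.2 ≤ T d.1 d.2 :=
  (T.row_weak_of_le h.2 (μ.up_left_mem h.1 le_rfl hd)).trans (T.col_weak h.1 hd)

end SemistandardYoungTableau

theorem IsLinearExtension.cells_eq {μ : YoungDiagram} {n : ℕ} {e : Fin n → ℕ × ℕ}
    (he : IsLinearExtension μ e) : μ.cells = Finset.univ.image e := by
  ext c
  rw [YoungDiagram.mem_cells, he.2.1 c]
  simp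

/-- The semistandard tableau with standardization `e` and weakly increasing content sequence `f`. -/
noncomputable def IsLinearExtension.tableau {μ : YoungDiagram} {n : ℕ} {e : Fin n → ℕ × ℕ}
    (he : IsLinearExtension μ e) {f : Fin n → ℕ} (hf : Monotone f)
    (hd : ∀ s : Fin (n - 1), s ∈ columnDescents e →
      f ⟨s, by omega⟩ < f ⟨s + 1, by omega⟩) : SemistandardYoungTableau μ where
  entry i j := Function.extend e f 0 (i, j)
  row_weak' {i j1 j2} h hc := by
    obtain ⟨k2, hk2⟩ := (he.2.1 _).1 hc
    obtain ⟨k1, hk1⟩ := (he.2.1 _).1 (μ.up_left_mem le_rfl h.le hc)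
    rw [← hk1, ← hk2, he.1.extend_apply, he.1.extend_apply]
    exact hf (he.2.2 _ _ (by rw [hk1, hk2]; exact ⟨le_rfl, h.le⟩))
  col_strict' {i1 i2 j} h hc := by
    obtain ⟨k2, hk2⟩ := (he.2.1 _).1 hc
    obtain ⟨k1, hk1⟩ := (he.2.1 _).1 (μ.up_left_mem h.le le_rfl hc)
    rw [← hk1, ← hk2, he.1.extend_apply, he.1.extend_apply]
    have hle : k1 ≤ k2 := he.2.2 _ _ (by rw [hk1, hk2]; exact ⟨h.le, le_rfl⟩)
    have hne : k1 ≠ k2 := by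
      rintro rfl
      rw [hk1] at hk2
      simp only [Prod.mk.injEq, and_true] at hk2
      omega
    have hlt := strictMono_lex_column hf hd (lt_of_le_of_ne hle hne)
    rw [Prod.Lex.toLex_lt_toLex] at hlt
    rcases hlt with hlt | ⟨-, hlt⟩
    · exact hlt
    · rw [hk1, hk2] at hlt
      exact absurd hlt (lt_irrefl _)
  zeros' {i j} hc := by
    rw [Function.extend_apply']
    · rfl
    · exact fun h => hc ((he.2.1 _).2 h)

theorem IsLinearExtension.tableau_apply {μ : YoungDiagram} {n : ℕ} {e : Fin n → ℕ × ℕ}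
    (he : IsLinearExtension μ e) {f : Fin n → ℕ} (hf : Monotone f)
    (hd : ∀ s : Fin (n - 1), s ∈ columnDescents e →
      f ⟨s, by omega⟩ < f ⟨s + 1, by omega⟩) (k : Fin n) :
    he.tableau hf hd (e k).1 (e k).2 = f k :=
  he.1.extend_apply f 0 k

/-- Standardization. Equal entries lie in different columns because columns are strict, so the key
(value, column) orders the cells totally; the key is monotone for the order of the cells. -/
theorem SemistandardYoungTableau.exists_linearExtension {μ : YoungDiagram}
    (T : SemistandardYoungTableau μ) {n : ℕ} (hn : μ.cells.card = n) :
    ∃ e : Fin n → ℕ × ℕ, IsLinearExtension μ e ∧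
      StrictMono fun k => toLex (T (e k).1 (e k).2, (e k).2) := by
  let key : ℕ × ℕ → ℕ ×ₗ ℕ := fun c => toLex (T c.1 c.2, c.2)
  have hinj : Set.InjOn key (μ.cells : Set (ℕ × ℕ)) := by
    rintro ⟨i, j⟩ hc ⟨i', j'⟩ hd h
    have hc : (i, j) ∈ μ := hc
    have hd : (i', j') ∈ μ := hd
    have h2 : toLex (T i j, j) = toLex (T i' j', j') := h
    rw [toLex_inj, Prod.mk.injEq] at h2
    obtain ⟨h2, rfl⟩ := h2
    rcases lt_trichotomy i i' with hlt | rfl | hlt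
    · exact absurd h2 (T.col_strict hlt hd).ne
    · rfl
    · exact absurd h2 (T.col_strict hlt hc).ne'
  have hcard : (μ.cells.image key).card = n := by rw [Finset.card_image_of_injOn hinj, hn]
  let o := (μ.cells.image key).orderEmbOfFin hcard
  have ho : ∀ k, ∃ c ∈ μ.cells, key c = o k := fun k =>
    Finset.mem_image.1 ((μ.cells.image key).orderEmbOfFin_mem hcard k)
  choose e hmem hkey using ho
  have hmono : StrictMono fun k => key (e k) := by
    intro a b hab
    simp only [hkey]
    exact o.strictMono hab
  refine ⟨e, ⟨fun a b hab => hmono.injective (congrArg key hab), fun c => ⟨fun hc => ?_, ?_⟩, ?_⟩,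
    hmono⟩
  · have : key c ∈ Set.range o := by
      rw [Finset.range_orderEmbOfFin]
      exact Finset.mem_coe.2 (Finset.mem_image_of_mem key hc)
    obtain ⟨k, hk⟩ := this
    exact ⟨k, hinj (hmem k) hc ((hkey k).trans hk)⟩
  · rintro ⟨k, rfl⟩
    exact hmem k
  · intro i j hij
    refine hmono.le_iff_le.1 ?_
    have h1 := T.le_of_cell_le hij (hmem j)
    rw [Prod.Lex.toLex_le_toLex]
    rcases h1.lt_or_eq with h | h
    · exact Or.inl h
    · exact Or.inr ⟨h, hij.2⟩

theorem finite_monotone_content {n : ℕ} (p : (Fin n → ℕ) → Prop) (q : (Fin n → ℕ) → Prop)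
    (m : ℕ →₀ ℕ) :
    Finite {f : Fin n → ℕ // p f ∧ q f ∧ ∑ k, Finsupp.single (f k) 1 = m} := by
  have : Set.Finite {f : Fin n → ℕ | ∀ k, f k ∈ (m.support : Set ℕ)} :=
    Set.Finite.pi' fun _ => m.support.finite_toSet
  refine (Set.Finite.subset this ?_ :
    Set.Finite {f | p f ∧ q f ∧ ∑ k, Finsupp.single (f k) 1 = m}).to_subtype
  rintro f ⟨-, -, rfl⟩ k
  rw [Finset.mem_coe, Finsupp.mem_support_iff, Finsupp.finsetSum_apply]
  exact (Finset.sum_pos' (fun _ _ => Nat.zero_le _) ⟨k, Finset.mem_univ k, by simp⟩).ne'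

/-- Standardization is a content-preserving bijection from semistandard tableaux to pairs of a
linear extension and a weakly increasing sequence that is strict at its column descents. For a
standard tableau these are the usual descents: the next cell is weakly to the left exactly when it
is strictly lower. -/
theorem schurFunction_eq_sum {ι : Type*} [Fintype ι] (μ : YoungDiagram) {n : ℕ}
    (E : ι → Fin n → ℕ × ℕ) (hinj : Function.Injective E)
    (hE : ∀ e, (∃ i, E i = e) ↔ IsLinearExtension μ e) (hn : μ.cells.card = n) :
    schurFunction μ = ∑ i, fundamentalQSym n (columnDescents (E i)) := by
  have hE' : ∀ i, IsLinearExtension μ (E i) := fun i => (hE _).1 ⟨i, rfl⟩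
  refine MvPowerSeries.ext fun m => ?_
  rw [map_sum]
  simp only [MvPowerSeries.coeff_apply, schurFunction, fundamentalQSym]
  rw [← Nat.cast_sum]
  have hfin := fun i : ι => finite_monotone_content (n := n) Monotone (fun f => ∀ s : Fin (n - 1),
    s ∈ columnDescents (E i) → f ⟨s, by omega⟩ < f ⟨s + 1, by omega⟩) m
  rw [← Nat.card_sigma]
  congr 1
  symm
  refine Nat.card_congr (Equiv.ofBijective
    (fun x => ⟨(hE' x.1).tableau x.2.2.1 x.2.2.2.1, ?_⟩) ⟨?_, ?_⟩)
  · rw [(hE' x.1).cells_eq, Finset.sum_image fun a _ b _ h => (hE' x.1).1 h]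
    simp only [IsLinearExtension.tableau_apply]
    exact x.2.2.2.2
  · rintro ⟨i, f, hf, hd, hm⟩ ⟨i', f', hf', hd', hm'⟩ h
    have hT := congrArg Subtype.val h
    dsimp only at hT
    set T := (hE' i).tableau hf hd with hTdef
    -- Both enumerations list the keys of the same cells of `T` in increasing order, and a strictly
    -- increasing function is determined by its range.
    have h1 : (fun k => toLex (T (E i k).1 (E i k).2, (E i k).2)) =
        fun k => toLex (T (E i' k).1 (E i' k).2, (E i' k).2) := by
      refine (StrictMono.range_inj ?_ ?_).1 ?_
      · simp only [hTdef, IsLinearExtension.tableau_apply]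
        exact strictMono_lex_column hf hd
      · simp only [hT, IsLinearExtension.tableau_apply]
        exact strictMono_lex_column hf' hd'
      · have h2 : ∀ e : Fin n → ℕ × ℕ, IsLinearExtension μ e →
            Set.range (fun k => toLex (T (e k).1 (e k).2, (e k).2)) =
              (fun c : ℕ × ℕ => toLex (T c.1 c.2, c.2)) '' {c | c ∈ μ} := by
          intro e he
          have : {c | c ∈ μ} = Set.range e := Set.ext he.2.1
          rw [this, ← Set.range_comp]
          rfl
        rw [h2 _ (hE' i), h2 _ (hE' i')]
    have hff : f = f' := by
      funext k
      have h2 := congrArg Prod.fst (toLex_inj.1 (congrFun h1 k))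
      dsimp only at h2
      conv_rhs at h2 => rw [hT]
      rwa [IsLinearExtension.tableau_apply, IsLinearExtension.tableau_apply] at h2
    have hii : i = i' := by
      apply hinj
      funext k
      have h2 := congrFun h1 k
      obtain ⟨k', hk'⟩ := ((hE' i').2.1 (E i k)).1 (((hE' i).2.1 _).2 ⟨k, rfl⟩)
      have hstrict : StrictMono fun k => toLex (T (E i' k).1 (E i' k).2, (E i' k).2) := by
        simp only [hT, IsLinearExtension.tableau_apply]
        exact strictMono_lex_column hf' hd'
      have : k' = k := hstrict.injective (by rw [← hk'] at h2; exact h2.symm ▸ rfl)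
      rw [← hk', this]
    subst hii hff
    rfl
  · rintro ⟨T, hT⟩
    obtain ⟨e, he, hmono⟩ := T.exists_linearExtension hn
    obtain ⟨i, rfl⟩ := (hE e).2 he
    have hfm : Monotone fun k => T (E i k).1 (E i k).2 := fun a b hab => by
      have := hmono.monotone hab
      rw [Prod.Lex.toLex_le_toLex] at this
      rcases this with h | h
      · exact h.le
      · exact h.1.le
    have hd : ∀ s : Fin (n - 1), s ∈ columnDescents (E i) →
        T (E i ⟨s, by omega⟩).1 (E i ⟨s, by omega⟩).2 <
          T (E i ⟨s + 1, by omega⟩).1 (E i ⟨s + 1, by omega⟩).2 := by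
      intro s hs
      have h := hmono (a := ⟨s, by omega⟩) (b := ⟨s + 1, by omega⟩) (Nat.lt_succ_self _)
      rw [Prod.Lex.toLex_lt_toLex] at h
      rcases h with h | h
      · exact h
      · exact absurd hs (not_le.2 h.2)
    refine ⟨⟨i, fun k => T (E i k).1 (E i k).2, hfm, hd, ?_⟩, Subtype.ext ?_⟩
    · rw [← hT, (hE' i).cells_eq, Finset.sum_image fun a _ b _ h => (hE' i).1 h]
    · refine SemistandardYoungTableau.ext fun a b => ?_
      by_cases hab : (a, b) ∈ μ
      · obtain ⟨k, hk⟩ := ((hE' i).2.1 (a, b)).1 hab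
        have := (hE' i).tableau_apply hfm hd k
        rw [hk] at this
        exact this
      · rw [SemistandardYoungTableau.zeros _ hab, SemistandardYoungTableau.zeros _ hab]

/-! ### Standard tableaux as computable lists -/

/-- The linear extensions of the set of cells in the list `l`, as lists. -/
def linearExtensions (l : List (ℕ × ℕ)) : List (List (ℕ × ℕ)) :=
  l.permutations'.filter fun L => L.Pairwise fun c d => ¬ d ≤ c

theorem mem_linearExtensions {l L : List (ℕ × ℕ)} :
    L ∈ linearExtensions l ↔ L.Perm l ∧ L.Pairwise fun c d => ¬ d ≤ c := by
  rw [linearExtensions, List.mem_filter, decide_eq_true_iff, List.mem_permutations']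

/-- The fundamental quasisymmetric function whose descents are given by a list of booleans. -/
noncomputable def qsymOfBits (n : ℕ) (D : List Bool) : MvPowerSeries ℕ ℤ :=
  fundamentalQSym n {s | D[(s : ℕ)]? = some true}

theorem List.nodup_permutations' {α : Type*} {l : List α} (h : l.Nodup) : l.permutations'.Nodup :=
  (List.permutations_perm_permutations' l).nodup_iff.1 (List.nodup_permutations l h)

theorem schurFunction_eq_list_sum (μ : YoungDiagram) (l : List (ℕ × ℕ)) (hl : l.Nodup)
    (hμ : μ.cells = l.toFinset) :
    schurFunction μ = (((linearExtensions l).map fun L =>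
      List.zipWith (fun c d => decide (d.2 ≤ c.2)) L L.tail).map (qsymOfBits l.length)).sum := by
  have hperm : ∀ L : {L // L ∈ (linearExtensions l).toFinset}, L.1.Perm l := by
    rintro ⟨L, hL⟩
    rw [List.mem_toFinset, mem_linearExtensions] at hL
    exact hL.1
  have hmem : ∀ c, c ∈ μ ↔ c ∈ l := fun c => by
    rw [← YoungDiagram.mem_cells, hμ, List.mem_toFinset]
  rw [List.map_map, ← List.sum_toFinset _ (l := linearExtensions l)
    ((List.nodup_permutations' hl).filter _),
    ← Finset.sum_coe_sort]
  rw [schurFunction_eq_sum (n := l.length) (ι := {L // L ∈ (linearExtensions l).toFinset}) μ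
    (fun L k => L.1[(k : ℕ)]'(by rw [(hperm L).length_eq]; exact k.2))]
  · refine Finset.sum_congr rfl fun L _ => ?_
    simp only [Function.comp_apply, qsymOfBits]
    congr 1
    ext s
    have h1 : (s : ℕ) < L.1.length := by rw [(hperm L).length_eq]; omega
    have h2 : (s : ℕ) + 1 < L.1.length := by rw [(hperm L).length_eq]; omega
    simp [columnDescents, List.getElem?_zipWith, h1, h2]
  · intro L L' h
    refine Subtype.ext (List.ext_getElem ?_ fun k h1 h2 => ?_)
    · rw [(hperm L).length_eq, (hperm L').length_eq]
    · exact congrFun h ⟨k, by rwa [(hperm L).length_eq] at h1⟩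
  · intro e
    constructor
    · rintro ⟨L, rfl⟩
      have hL := L.2
      rw [List.mem_toFinset, mem_linearExtensions] at hL
      refine ⟨?_, fun c => ?_, ?_⟩
      · intro a b hab
        exact Fin.ext ((((hperm L).nodup_iff.2 hl).getElem_inj_iff).1 hab)
      · rw [hmem, ← (hperm L).mem_iff, List.mem_iff_getElem]
        constructor
        · rintro ⟨k, hk, rfl⟩
          exact ⟨⟨k, by rwa [(hperm L).length_eq] at hk⟩, rfl⟩
        · rintro ⟨k, rfl⟩
          exact ⟨k, by rw [(hperm L).length_eq]; exact k.2, rfl⟩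
      · intro i j hij
        by_contra hlt
        exact List.pairwise_iff_getElem.1 hL.2 j i _ _ (not_le.1 hlt) hij
    · rintro ⟨h1, h2, h3⟩
      refine ⟨⟨List.ofFn e, ?_⟩, ?_⟩
      · rw [List.mem_toFinset, mem_linearExtensions]
        refine ⟨(List.perm_ext_iff_of_nodup (List.nodup_ofFn.2 h1) hl).2 fun c => ?_, ?_⟩
        · rw [← hmem, h2, List.mem_ofFn, Set.mem_range]
        · rw [List.pairwise_ofFn]
          intro i j hij hle
          exact absurd (h3 _ _ hle) (not_le.2 hij)
      · funext k
        simp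
  · rw [hμ, List.toFinset_card_of_nodup hl]

/-! ## Schur positivity of balanced functions on permutations -/

theorem SchurPositive.zero : SchurPositive 0 := ⟨0, by simp⟩

theorem SchurPositive.schurFunction (μ : YoungDiagram) : SchurPositive (schurFunction μ) :=
  ⟨Finsupp.single μ 1, by simp⟩

theorem SchurPositive.add {F F' : MvPowerSeries ℕ ℤ} (h : SchurPositive F)
    (h' : SchurPositive F') : SchurPositive (F + F') := by
  obtain ⟨c, rfl⟩ := h
  obtain ⟨c', rfl⟩ := h'
  refine ⟨c + c', (Finsupp.sum_add_index' (fun _ => ?_) fun _ _ _ => ?_).symm⟩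
  · exact zero_smul ℕ _
  · exact add_smul _ _ _

theorem SchurPositive.nsmul {F : MvPowerSeries ℕ ℤ} (h : SchurPositive F) (k : ℕ) :
    SchurPositive (k • F) := by
  induction k with
  | zero => simpa using SchurPositive.zero
  | succ k ih => rw [succ_nsmul]; exact ih.add h

/-- The Young diagram with row lengths `w`. -/
abbrev rowShape (w : List ℕ) (hw : w.SortedGE := by decide) : YoungDiagram :=
  YoungDiagram.ofRowLens w hw

/-! ### Expansions of the Schur functions of degrees 4 and 5 -/

theorem schurFunction_4 : schurFunction (rowShape [4]) =
    ([[false, false, false]].map (qsymOfBits 4)).sum := by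
  rw [schurFunction_eq_list_sum _ [(0, 0), (0, 1), (0, 2), (0, 3)]
    (by decide) (by decide)]
  -- The list of linear extensions and its descents evaluate, so the remaining equality of lists
  -- holds by computation.
  congr 2

theorem schurFunction_31 : schurFunction (rowShape [3, 1]) =
    ([[false, false, true], [false, true, false], [true, false, false]].map (qsymOfBits 4)).sum := by
  rw [schurFunction_eq_list_sum _ [(0, 0), (0, 1), (0, 2), (1, 0)]
    (by decide) (by decide)]
  congr 2

theorem schurFunction_22 : schurFunction (rowShape [2, 2]) =
    ([[false, true, false], [true, false, true]].map (qsymOfBits 4)).sum := by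
  rw [schurFunction_eq_list_sum _ [(0, 0), (0, 1), (1, 0), (1, 1)]
    (by decide) (by decide)]
  congr 2

theorem schurFunction_211 : schurFunction (rowShape [2, 1, 1]) =
    ([[false, true, true], [true, false, true], [true, true, false]].map (qsymOfBits 4)).sum := by
  rw [schurFunction_eq_list_sum _ [(0, 0), (0, 1), (1, 0), (2, 0)]
    (by decide) (by decide)]
  congr 2

theorem schurFunction_1111 : schurFunction (rowShape [1, 1, 1, 1]) =
    ([[true, true, true]].map (qsymOfBits 4)).sum := by
  rw [schurFunction_eq_list_sum _ [(0, 0), (1, 0), (2, 0), (3, 0)]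
    (by decide) (by decide)]
  congr 2

theorem schurFunction_5 : schurFunction (rowShape [5]) =
    ([[false, false, false, false]].map (qsymOfBits 5)).sum := by
  rw [schurFunction_eq_list_sum _ [(0, 0), (0, 1), (0, 2), (0, 3), (0, 4)]
    (by decide) (by decide)]
  congr 2

theorem schurFunction_41 : schurFunction (rowShape [4, 1]) =
    ([[false, false, false, true], [false, false, true, false], [false, true, false, false], [true, false, false, false]].map (qsymOfBits 5)).sum := by
  rw [schurFunction_eq_list_sum _ [(0, 0), (0, 1), (0, 2), (0, 3), (1, 0)]
    (by decide) (by decide)]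
  congr 2

theorem schurFunction_32 : schurFunction (rowShape [3, 2]) =
    ([[false, false, true, false], [false, true, false, true], [true, false, false, true], [false, true, false, false], [true, false, true, false]].map (qsymOfBits 5)).sum := by
  rw [schurFunction_eq_list_sum _ [(0, 0), (0, 1), (0, 2), (1, 0), (1, 1)]
    (by decide) (by decide)]
  congr 2

theorem schurFunction_311 : schurFunction (rowShape [3, 1, 1]) =
    ([[false, false, true, true], [false, true, false, true], [true, false, false, true], [false, true, true, false], [true, false, true, false], [true, true, false, false]].map (qsymOfBits 5)).sum := by
  rw [schurFunction_eq_list_sum _ [(0, 0), (0, 1), (0, 2), (1, 0), (2, 0)]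
    (by decide) (by decide)]
  congr 2

theorem schurFunction_221 : schurFunction (rowShape [2, 2, 1]) =
    ([[false, true, false, true], [true, false, true, true], [false, true, true, false], [true, false, true, false], [true, true, false, true]].map (qsymOfBits 5)).sum := by
  rw [schurFunction_eq_list_sum _ [(0, 0), (0, 1), (1, 0), (1, 1), (2, 0)]
    (by decide) (by decide)]
  congr 2

theorem schurFunction_2111 : schurFunction (rowShape [2, 1, 1, 1]) =
    ([[false, true, true, true], [true, false, true, true], [true, true, false, true], [true, true, true, false]].map (qsymOfBits 5)).sum := by
  rw [schurFunction_eq_list_sum _ [(0, 0), (0, 1), (1, 0), (2, 0), (3, 0)]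
    (by decide) (by decide)]
  congr 2

theorem schurFunction_11111 : schurFunction (rowShape [1, 1, 1, 1, 1]) =
    ([[true, true, true, true]].map (qsymOfBits 5)).sum := by
  rw [schurFunction_eq_list_sum _ [(0, 0), (1, 0), (2, 0), (3, 0), (4, 0)]
    (by decide) (by decide)]
  congr 2

/-! ### Balanced functions and their descent class sums -/

/-- A function on words is balanced if on each square `v bac w, v bca w, v acb w, v cab w` its sum
over the two words with a descent at `ba` or `ca` is its sum over the two other words. -/
def IsBalanced {α : Type*} [LT α] (g : List α → ℕ) : Prop :=
  ∀ (v w : List α) (a b c : α), a < b → b < c →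
    g (v ++ [b, a, c] ++ w) + g (v ++ [c, a, b] ++ w) =
      g (v ++ [b, c, a] ++ w) + g (v ++ [a, c, b] ++ w)

/-- The descents of a word, as a list of booleans. -/
def wordDescents {α : Type*} [LinearOrder α] (p : List α) : List Bool :=
  List.zipWith (fun a b => decide (b < a)) p p.tail

/-- The permutations of `Fin d`, as words. -/
def permWords (d : ℕ) : List (List (Fin d)) := (List.finRange d).permutations'

/-- The sum of `g` over the permutations with descents `D`. -/
def descentClassSum {d : ℕ} (g : List (Fin d) → ℕ) (D : List Bool) : ℕ :=
  (((permWords d).filter fun p => wordDescents p = D).map g).sum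

theorem List.sum_map_smul_fiberwise {α β M : Type*} [DecidableEq β] [AddCommMonoid M] (P : List α)
    {Ds : List β} (hDs : Ds.Nodup) (f : α → β) (hf : ∀ p ∈ P, f p ∈ Ds) (g : α → ℕ) (q : β → M) :
    (P.map fun p => g p • q (f p)).sum =
      (Ds.map fun D => ((P.filter fun p => f p = D).map g).sum • q D).sum := by
  induction P with
  | nil => simp
  | cons p P ih =>
    rw [List.map_cons, List.sum_cons, ih fun x hx => hf x (List.mem_cons_of_mem _ hx)]
    have hp := hf p List.mem_cons_self
    have h1 : ∀ D, (((p :: P).filter fun p => f p = D).map g).sum • q D =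
        (if D = f p then g p • q (f p) else 0) +
          ((P.filter fun p => f p = D).map g).sum • q D := by
      intro D
      by_cases h : f p = D
      · subst h; simp [add_smul]
      · simp [h, Ne.symm h]
    simp only [h1, List.sum_map_add]
    congr 1
    rw [← List.sum_toFinset _ hDs, Finset.sum_ite_eq', if_pos (List.mem_toFinset.2 hp)]

/-- The possible descents of a word of length `4`. -/
def descentBits4 : List (List Bool) :=
  [[false, false, false], [false, false, true], [false, true, false], [false, true, true], [true, false, false], [true, false, true], [true, true, false], [true, true, true]]

theorem filter_permWords_4 : descentBits4.map (fun D =>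
    (permWords 4).filter fun p => wordDescents p = D) =
    [[[0, 1, 2, 3]], [[1, 2, 3, 0], [0, 2, 3, 1], [0, 1, 3, 2]], [[1, 2, 0, 3], [0, 2, 1, 3], [2, 3, 0, 1], [1, 3, 0, 2], [0, 3, 1, 2]], [[2, 3, 1, 0], [1, 3, 2, 0], [0, 3, 2, 1]], [[1, 0, 2, 3], [2, 0, 1, 3], [3, 0, 1, 2]], [[2, 1, 3, 0], [2, 0, 3, 1], [1, 0, 3, 2], [3, 1, 2, 0], [3, 0, 2, 1]], [[2, 1, 0, 3], [3, 1, 0, 2], [3, 2, 0, 1]], [[3, 2, 1, 0]]] := by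
  decide +kernel

/-- The right-hand list consists of the coefficients of the fundamental functions in the combination
of Schur functions with multiplicities `c4, …, c1111`. The identity is a linear consequence of the
balance equations. -/
theorem IsBalanced.descentClassSum_4 {g : List (Fin 4) → ℕ} (hg : IsBalanced g) :
    ∃ c4 c31 c22 c211 c1111 : ℕ, descentBits4.map (descentClassSum g) =
      [c4, c31, c31 + c22, c211, c31, c22 + c211, c211, c1111] := by
  have s0 (a b c d : Fin 4) (hab : a < b) (hbc : b < c) :
      g [b, a, c, d] + g [c, a, b, d] = g [b, c, a, d] + g [a, c, b, d] :=
    hg [] [d] a b c hab hbc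
  have s1 (a b c d : Fin 4) (hab : a < b) (hbc : b < c) :
      g [d, b, a, c] + g [d, c, a, b] = g [d, b, c, a] + g [d, a, c, b] :=
    hg [d] [] a b c hab hbc
  -- All squares: four triples of letters in each of the two windows.
  have r0 := s0 0 1 2 3 (by decide) (by decide)
  have r1 := s0 1 2 3 0 (by decide) (by decide)
  have r2 := s0 0 2 3 1 (by decide) (by decide)
  have r3 := s0 0 1 3 2 (by decide) (by decide)
  have r4 := s1 1 2 3 0 (by decide) (by decide)
  have r5 := s1 0 2 3 1 (by decide) (by decide)
  have r6 := s1 0 1 3 2 (by decide) (by decide)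
  have r7 := s1 0 1 2 3 (by decide) (by decide)
  -- For a hook, the multiplicity is the sum over a descent class that occurs in no other Schur
  -- function. For `(2, 2)` there is no such class; one word is taken from each of the two Knuth
  -- classes of that shape.
  refine ⟨descentClassSum g [false, false, false], descentClassSum g [true, false, false], (g [1, 0, 3, 2] + g [2, 3, 0, 1]), descentClassSum g [true, true, false], descentClassSum g [true, true, true], ?_⟩
  have hc := filter_permWords_4
  simp only [descentBits4, List.map_cons, List.map_nil, List.cons.injEq, and_true] at hc ⊢
  obtain ⟨-, h1, h2, h3, h4, h5, h6, -⟩ := hc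
  simp only [descentClassSum, h1, h2, h3, h4, h5, h6, List.map_cons, List.map_nil, List.sum_cons, List.sum_nil]
  clear h1 h2 h3 h4 h5 h6 s0 s1 hg
  repeat' apply And.intro
  all_goals grind

theorem IsBalanced.schurPositive_4 {g : List (Fin 4) → ℕ} (hg : IsBalanced g) :
    SchurPositive ((permWords 4).map fun p => g p • qsymOfBits 4 (wordDescents p)).sum := by
  rw [List.sum_map_smul_fiberwise _ (Ds := descentBits4) (by decide +kernel) _ (by decide +kernel)]
  obtain ⟨c4, c31, c22, c211, c1111, h⟩ := hg.descentClassSum_4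
  change SchurPositive (descentBits4.map fun D => descentClassSum g D • qsymOfBits 4 D).sum
  have hpos : SchurPositive (c4 • schurFunction (rowShape [4]) + c31 • schurFunction (rowShape [3, 1]) + c22 • schurFunction (rowShape [2, 2]) + c211 • schurFunction (rowShape [2, 1, 1]) + c1111 • schurFunction (rowShape [1, 1, 1, 1])) := by
    repeat' first | apply SchurPositive.add | exact (SchurPositive.schurFunction _).nsmul _
  convert hpos using 1
  simp only [descentBits4, List.map_cons, List.map_nil, List.cons.injEq, and_true,
    List.sum_cons, List.sum_nil] at h ⊢
  obtain ⟨h0, h1, h2, h3, h4, h5, h6, h7⟩ := h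
  rw [h0, h1, h2, h3, h4, h5, h6, h7]
  simp only [schurFunction_4, schurFunction_31, schurFunction_22, schurFunction_211, schurFunction_1111, List.map_cons, List.map_nil,
    List.sum_cons, List.sum_nil]
  module

/-- The possible descents of a word of length `5`. -/
def descentBits5 : List (List Bool) :=
  [[false, false, false, false], [false, false, false, true], [false, false, true, false], [false, false, true, true], [false, true, false, false], [false, true, false, true], [false, true, true, false], [false, true, true, true], [true, false, false, false], [true, false, false, true], [true, false, true, false], [true, false, true, true], [true, true, false, false], [true, true, false, true], [true, true, true, false], [true, true, true, true]]

theorem filter_permWords_5 : descentBits5.map (fun D =>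
    (permWords 5).filter fun p => wordDescents p = D) =
    [[[0, 1, 2, 3, 4]], [[1, 2, 3, 4, 0], [0, 2, 3, 4, 1], [0, 1, 3, 4, 2], [0, 1, 2, 4, 3]], [[1, 2, 3, 0, 4], [0, 2, 3, 1, 4], [2, 3, 4, 0, 1], [0, 1, 3, 2, 4], [1, 3, 4, 0, 2], [0, 3, 4, 1, 2], [1, 2, 4, 0, 3], [0, 2, 4, 1, 3], [0, 1, 4, 2, 3]], [[2, 3, 4, 1, 0], [1, 3, 4, 2, 0], [0, 3, 4, 2, 1], [1, 2, 4, 3, 0], [0, 2, 4, 3, 1], [0, 1, 4, 3, 2]], [[1, 2, 0, 3, 4], [0, 2, 1, 3, 4], [2, 3, 0, 1, 4], [1, 3, 0, 2, 4], [0, 3, 1, 2, 4], [3, 4, 0, 1, 2], [2, 4, 0, 1, 3], [1, 4, 0, 2, 3], [0, 4, 1, 2, 3]], [[2, 3, 1, 4, 0], [2, 3, 0, 4, 1], [1, 3, 2, 4, 0], [0, 3, 2, 4, 1], [1, 3, 0, 4, 2], [0, 3, 1, 4, 2], [3, 4, 1, 2, 0], [3, 4, 0, 2, 1], [1, 2,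 0, 4, 3], [0, 2, 1, 4, 3], [2, 4, 1, 3, 0], [2, 4, 0, 3, 1], [1, 4, 2, 3, 0], [0, 4, 2, 3, 1], [1, 4, 0, 3, 2], [0, 4, 1, 3, 2]], [[2, 3, 1, 0, 4], [1, 3, 2, 0, 4], [0, 3, 2, 1, 4], [3, 4, 1, 0, 2], [3, 4, 2, 0, 1], [2, 4, 1, 0, 3], [2, 4, 3, 0, 1], [1, 4, 2, 0, 3], [0, 4, 2, 1, 3], [1, 4, 3, 0, 2], [0, 4, 3, 1, 2]], [[3, 4, 2, 1, 0], [2, 4, 3, 1, 0], [1, 4, 3, 2, 0], [0, 4, 3, 2, 1]], [[1, 0, 2, 3, 4], [2, 0, 1, 3, 4], [3, 0, 1, 2, 4], [4, 0, 1, 2, 3]], [[2, 1, 3, 4, 0], [2, 0, 3, 4, 1], [3, 1, 2, 4, 0], [3, 0, 2, 4, 1], [1, 0, 3, 4, 2], [3, 0, 1, 4, 2], [1, 0, 2, 4, 3], [2, 0, 1, 4, 3], [4, 1, 2, 3, 0], [4, 0, 2, 3, 1], [4, 0, 1, 3, 2]], [[2, 1, 3, 0, 4], [2, 0, 3, 1,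 4], [1, 0, 3, 2, 4], [3, 1, 2, 0, 4], [3, 0, 2, 1, 4], [3, 2, 4, 0, 1], [3, 1, 4, 0, 2], [3, 0, 4, 1, 2], [2, 1, 4, 0, 3], [2, 0, 4, 1, 3], [1, 0, 4, 2, 3], [4, 1, 2, 0, 3], [4, 0, 2, 1, 3], [4, 2, 3, 0, 1], [4, 1, 3, 0, 2], [4, 0, 3, 1, 2]], [[3, 2, 4, 1, 0], [3, 1, 4, 2, 0], [3, 0, 4, 2, 1], [2, 1, 4, 3, 0], [2, 0, 4, 3, 1], [4, 2, 3, 1, 0], [1, 0, 4, 3, 2], [4, 1, 3, 2, 0], [4, 0, 3, 2, 1]], [[2, 1, 0, 3, 4], [3, 1, 0, 2, 4], [3, 2, 0, 1, 4], [4, 1, 0, 2, 3], [4, 2, 0, 1, 3], [4, 3, 0, 1, 2]], [[3, 2, 1, 4, 0], [3, 2, 0, 4, 1], [3, 1, 0, 4, 2], [2, 1, 0, 4, 3], [4, 2, 1, 3, 0], [4, 2, 0, 3, 1], [4, 1, 0, 3, 2], [4, 3, 1, 2, 0], [4, 3, 0, 2, 1]], [[3, 2, 1, 0, 4], [4, 2,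 1, 0, 3], [4, 3, 1, 0, 2], [4, 3, 2, 0, 1]], [[4, 3, 2, 1, 0]]] := by
  decide +kernel

theorem IsBalanced.descentClassSum_5 {g : List (Fin 5) → ℕ} (hg : IsBalanced g) :
    ∃ c5 c41 c32 c311 c221 c2111 c11111 : ℕ, descentBits5.map (descentClassSum g) =
      [c5, c41, c41 + c32, c311, c41 + c32, c32 + c311 + c221, c311 + c221, c2111, c41, c32 + c311, c32 + c311 + c221, c221 + c2111, c311, c221 + c2111, c2111, c11111] := by
  have s0 (a b c d e : Fin 5) (hab : a < b) (hbc : b < c) :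
      g [b, a, c, d, e] + g [c, a, b, d, e] = g [b, c, a, d, e] + g [a, c, b, d, e] :=
    hg [] [d, e] a b c hab hbc
  have s1 (a b c d e : Fin 5) (hab : a < b) (hbc : b < c) :
      g [d, b, a, c, e] + g [d, c, a, b, e] = g [d, b, c, a, e] + g [d, a, c, b, e] :=
    hg [d] [e] a b c hab hbc
  have s2 (a b c d e : Fin 5) (hab : a < b) (hbc : b < c) :
      g [d, e, b, a, c] + g [d, e, c, a, b] = g [d, e, b, c, a] + g [d, e, a, c, b] :=
    hg [d, e] [] a b c hab hbc
  -- All squares: ten triples, two orders of the other letters, three windows.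
  have r0 := s0 0 1 2 3 4 (by decide) (by decide)
  have r1 := s0 1 2 3 0 4 (by decide) (by decide)
  have r2 := s0 1 2 3 4 0 (by decide) (by decide)
  have r3 := s0 0 2 3 1 4 (by decide) (by decide)
  have r4 := s0 0 2 3 4 1 (by decide) (by decide)
  have r5 := s0 2 3 4 0 1 (by decide) (by decide)
  have r6 := s0 2 3 4 1 0 (by decide) (by decide)
  have r7 := s0 0 1 3 2 4 (by decide) (by decide)
  have r8 := s0 0 1 3 4 2 (by decide) (by decide)
  have r9 := s0 1 3 4 0 2 (by decide) (by decide)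
  have r10 := s0 1 3 4 2 0 (by decide) (by decide)
  have r11 := s0 0 3 4 1 2 (by decide) (by decide)
  have r12 := s0 0 3 4 2 1 (by decide) (by decide)
  have r13 := s0 0 1 2 4 3 (by decide) (by decide)
  have r14 := s0 1 2 4 0 3 (by decide) (by decide)
  have r15 := s0 1 2 4 3 0 (by decide) (by decide)
  have r16 := s0 0 2 4 1 3 (by decide) (by decide)
  have r17 := s0 0 2 4 3 1 (by decide) (by decide)
  have r18 := s0 0 1 4 2 3 (by decide) (by decide)
  have r19 := s0 0 1 4 3 2 (by decide) (by decide)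
  have r20 := s1 1 2 3 0 4 (by decide) (by decide)
  have r21 := s1 0 2 3 1 4 (by decide) (by decide)
  have r22 := s1 2 3 4 1 0 (by decide) (by decide)
  have r23 := s1 0 1 3 2 4 (by decide) (by decide)
  have r24 := s1 1 3 4 2 0 (by decide) (by decide)
  have r25 := s1 2 3 4 0 1 (by decide) (by decide)
  have r26 := s1 0 3 4 2 1 (by decide) (by decide)
  have r27 := s1 0 1 2 3 4 (by decide) (by decide)
  have r28 := s1 1 2 4 3 0 (by decide) (by decide)
  have r29 := s1 0 2 4 3 1 (by decide) (by decide)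
  have r30 := s1 1 3 4 0 2 (by decide) (by decide)
  have r31 := s1 0 3 4 1 2 (by decide) (by decide)
  have r32 := s1 0 1 4 3 2 (by decide) (by decide)
  have r33 := s1 1 2 4 0 3 (by decide) (by decide)
  have r34 := s1 0 2 4 1 3 (by decide) (by decide)
  have r35 := s1 0 1 4 2 3 (by decide) (by decide)
  have r36 := s1 0 1 2 4 3 (by decide) (by decide)
  have r37 := s1 1 2 3 4 0 (by decide) (by decide)
  have r38 := s1 0 2 3 4 1 (by decide) (by decide)
  have r39 := s1 0 1 3 4 2 (by decide) (by decide)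
  have r40 := s2 2 3 4 0 1 (by decide) (by decide)
  have r41 := s2 2 3 4 1 0 (by decide) (by decide)
  have r42 := s2 0 3 4 1 2 (by decide) (by decide)
  have r43 := s2 1 3 4 0 2 (by decide) (by decide)
  have r44 := s2 1 3 4 2 0 (by decide) (by decide)
  have r45 := s2 0 3 4 2 1 (by decide) (by decide)
  have r46 := s2 0 1 4 2 3 (by decide) (by decide)
  have r47 := s2 0 2 4 1 3 (by decide) (by decide)
  have r48 := s2 1 2 4 0 3 (by decide) (by decide)
  have r49 := s2 1 2 4 3 0 (by decide) (by decide)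
  have r50 := s2 0 2 4 3 1 (by decide) (by decide)
  have r51 := s2 0 1 4 3 2 (by decide) (by decide)
  have r52 := s2 0 1 2 3 4 (by decide) (by decide)
  have r53 := s2 0 1 3 2 4 (by decide) (by decide)
  have r54 := s2 0 2 3 1 4 (by decide) (by decide)
  have r55 := s2 1 2 3 0 4 (by decide) (by decide)
  have r56 := s2 1 2 3 4 0 (by decide) (by decide)
  have r57 := s2 0 2 3 4 1 (by decide) (by decide)
  have r58 := s2 0 1 3 4 2 (by decide) (by decide)
  have r59 := s2 0 1 2 4 3 (by decide) (by decide)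
  -- As in degree 4: hooks have a descent class of their own, while for `(3, 2)` and for `(2, 2, 1)`
  -- the five words represent the five Knuth classes of the shape.
  refine ⟨descentClassSum g [false, false, false, false], descentClassSum g [true, false, false, false], (g [1, 0, 3, 2, 4] + g [1, 0, 4, 2, 3] + g [2, 3, 0, 1, 4] + g [2, 4, 0, 1, 3] + g [3, 4, 0, 1, 2]), descentClassSum g [true, true, false, false], (g [2, 1, 0, 4, 3] + g [3, 1, 0, 4, 2] + g [3, 2, 4, 0, 1] + g [4, 1, 0, 3, 2] + g [4, 2, 3, 0, 1]), descentClassSum g [true, true, true, false], descentClassSum g [true, true, true, true], ?_⟩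
  have hc := filter_permWords_5
  simp only [descentBits5, List.map_cons, List.map_nil, List.cons.injEq, and_true] at hc ⊢
  obtain ⟨-, h1, h2, h3, h4, h5, h6, h7, h8, h9, h10, h11, h12, h13, h14, -⟩ := hc
  simp only [descentClassSum, h1, h2, h3, h4, h5, h6, h7, h8, h9, h10, h11, h12, h13, h14, List.map_cons, List.map_nil, List.sum_cons, List.sum_nil]
  clear h1 h2 h3 h4 h5 h6 h7 h8 h9 h10 h11 h12 h13 h14 s0 s1 s2 hg
  repeat' apply And.intro
  all_goals grind

theorem IsBalanced.schurPositive_5 {g : List (Fin 5) → ℕ} (hg : IsBalanced g) :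
    SchurPositive ((permWords 5).map fun p => g p • qsymOfBits 5 (wordDescents p)).sum := by
  rw [List.sum_map_smul_fiberwise _ (Ds := descentBits5) (by decide +kernel) _ (by decide +kernel)]
  obtain ⟨c5, c41, c32, c311, c221, c2111, c11111, h⟩ := hg.descentClassSum_5
  change SchurPositive (descentBits5.map fun D => descentClassSum g D • qsymOfBits 5 D).sum
  have hpos : SchurPositive (c5 • schurFunction (rowShape [5]) + c41 • schurFunction (rowShape [4, 1]) + c32 • schurFunction (rowShape [3, 2]) + c311 • schurFunction (rowShape [3, 1, 1]) + c221 • schurFunction (rowShape [2, 2, 1]) + c2111 • schurFunction (rowShape [2, 1, 1, 1]) + c11111 • schurFunction (rowShape [1, 1, 1, 1, 1])) := by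
    repeat' first | apply SchurPositive.add | exact (SchurPositive.schurFunction _).nsmul _
  convert hpos using 1
  simp only [descentBits5, List.map_cons, List.map_nil, List.cons.injEq, and_true,
    List.sum_cons, List.sum_nil] at h ⊢
  obtain ⟨h0, h1, h2, h3, h4, h5, h6, h7, h8, h9, h10, h11, h12, h13, h14, h15⟩ := h
  rw [h0, h1, h2, h3, h4, h5, h6, h7, h8, h9, h10, h11, h12, h13, h14, h15]
  simp only [schurFunction_5, schurFunction_41, schurFunction_32, schurFunction_311, schurFunction_221, schurFunction_2111, schurFunction_11111, List.map_cons, List.map_nil,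
    List.sum_cons, List.sum_nil]
  module

/-! ## Words: edges and signs of a D₀ graph -/

namespace D0Graph

variable {N n : ℕ} (G : D0Graph N n)

/-- The words `x` and `y` form one of the four pairs allowed for an `i`-edge, and the descent of `x`
precedes that of `y`. -/
def IsOrientedPair {N : ℕ} (i : ℕ) (x y : List (Fin N)) : Prop :=
  ∃ (v w : List (Fin N)) (a b c : Fin N), a < b ∧ b < c ∧ v.length + 2 = i ∧
    (x = v ++ [b, a, c] ++ w ∨ x = v ++ [c, a, b] ++ w) ∧
    (y = v ++ [b, c, a] ++ w ∨ y = v ++ [a, c, b] ++ w)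

theorem isOrientedPair_of_adj {i : ℕ} {x y : G.verts} (h : (G.edge i).Adj x y) :
    IsOrientedPair i x.1 y.1 ∨ IsOrientedPair i y.1 x.1 := by
  rcases G.isPair i x y h with ⟨v, w, a, b, c, hab, hbc, hv, h | h⟩ |
    ⟨v, w, a, b, c, hab, hbc, hv, h | h⟩ <;>
  · rw [Set.pair_eq_pair_iff] at h
    rcases h with ⟨h1, h2⟩ | ⟨h1, h2⟩
    · first
        | exact Or.inl ⟨v, w, a, b, c, hab, hbc, hv, by tauto, by tauto⟩
        | exact Or.inr ⟨v, w, a, b, c, hab, hbc, hv, by tauto, by tauto⟩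
    · first
        | exact Or.inl ⟨v, w, a, b, c, hab, hbc, hv, by tauto, by tauto⟩
        | exact Or.inr ⟨v, w, a, b, c, hab, hbc, hv, by tauto, by tauto⟩

theorem existsUnique_adj_of_oriented {i : ℕ} {v w : List (Fin N)} {a b c : Fin N} (hab : a < b)
    (hbc : b < c) (hv : v.length + 2 = i) {x : G.verts}
    (hx : (x.1 = v ++ [b, a, c] ++ w ∨ x.1 = v ++ [c, a, b] ++ w) ∨
      (x.1 = v ++ [b, c, a] ++ w ∨ x.1 = v ++ [a, c, b] ++ w)) :
    ∃! y, (G.edge i).Adj x y :=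
  G.existsUnique_edge i v w a b c hab hbc hv x (by
    simp only [Set.mem_insert_iff, Set.mem_singleton_iff]; tauto)

theorem existsUnique_adj {i : ℕ} {x y : G.verts} (h : (G.edge i).Adj x y) :
    ∃! y, (G.edge i).Adj x y := by
  rcases G.isOrientedPair_of_adj h with ⟨v, w, a, b, c, hab, hbc, hv, h1, h2⟩ |
    ⟨v, w, a, b, c, hab, hbc, hv, h1, h2⟩
  · exact G.existsUnique_adj_of_oriented hab hbc hv (Or.inl h1)
  · exact G.existsUnique_adj_of_oriented hab hbc hv (Or.inr h2)

theorem axiom0 : G.toSignedColoredGraph.Axiom0 :=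
  fun _ _ _ _ h h' => (G.existsUnique_adj h).unique h h'

theorem sgn_eq {x : G.verts} {p q : List (Fin N)} {r s : Fin N} (hx : x.1 = p ++ r :: s :: q)
    {k : ℕ} (hk : p.length + 1 = k) :
    G.toSignedColoredGraph.sgn x k = if r ≤ s then 1 else -1 := by
  subst hk
  have hlen := G.length_eq x.1 x.2
  rw [hx] at hlen
  simp only [List.length_append, List.length_cons] at hlen
  rw [SignedColoredGraph.sgn, dif_pos ⟨by omega, by omega⟩]
  simp only [toSignedColoredGraph, hx, Nat.add_sub_cancel]
  simp

theorem sgn_congr {x y : G.verts} {k : ℕ} (h1 : x.1[k - 1]? = y.1[k - 1]?)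
    (h2 : x.1[k]? = y.1[k]?) :
    G.toSignedColoredGraph.sgn x k = G.toSignedColoredGraph.sgn y k := by
  unfold SignedColoredGraph.sgn
  by_cases hk : 1 ≤ k ∧ k < n
  · rw [dif_pos hk, dif_pos hk]
    obtain ⟨k, rfl⟩ : ∃ m, k = m + 1 := ⟨k - 1, by omega⟩
    have hx := G.length_eq x.1 x.2
    have hy := G.length_eq y.1 y.2
    simp only [Nat.add_sub_cancel] at h1
    rw [List.getElem?_eq_getElem (by omega), List.getElem?_eq_getElem (by omega)] at h1 h2
    simp only [toSignedColoredGraph, Nat.add_sub_cancel, Option.some.inj h1, Option.some.inj h2]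
  · rw [dif_neg hk, dif_neg hk]

theorem exists_split {x : G.verts} {i : ℕ} (h2 : 2 ≤ i) (hi : i < n) :
    ∃ v r s t w, x.1 = v ++ [r, s, t] ++ w ∧ v.length + 2 = i := by
  have hx := G.length_eq x.1 x.2
  refine ⟨x.1.take (i - 2), x.1[i - 2], x.1[i - 1], x.1[i], x.1.drop (i + 1), ?_, ?_⟩
  · rw [List.append_assoc, List.cons_append, List.cons_append, List.singleton_append]
    conv_lhs => rw [← List.take_append_drop (i - 2) x.1]
    congr 1
    rw [List.drop_eq_getElem_cons (by omega), List.drop_eq_getElem_cons (by omega),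
      List.drop_eq_getElem_cons (by omega)]
    simp only [show i - 2 + 1 = i - 1 by omega, show i - 1 + 1 = i by omega]
  · rw [List.length_take]; omega

theorem sgn_left {x : G.verts} {v w : List (Fin N)} {r s t : Fin N} {i : ℕ}
    (hx : x.1 = v ++ [r, s, t] ++ w) (hv : v.length + 2 = i) :
    G.toSignedColoredGraph.sgn x (i - 1) = if r ≤ s then 1 else -1 :=
  G.sgn_eq (p := v) (q := t :: w) (by simp [hx]) (by omega)

theorem sgn_right {x : G.verts} {v w : List (Fin N)} {r s t : Fin N} {i : ℕ}
    (hx : x.1 = v ++ [r, s, t] ++ w) (hv : v.length + 2 = i) :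
    G.toSignedColoredGraph.sgn x i = if s ≤ t then 1 else -1 :=
  G.sgn_eq (p := v ++ [r]) (q := w) (by simp [hx]) (by simp; omega)

theorem sgn_of_oriented {i : ℕ} {x y : G.verts} (h : IsOrientedPair i x.1 y.1) :
    G.toSignedColoredGraph.sgn x (i - 1) = -1 ∧ G.toSignedColoredGraph.sgn x i = 1 ∧
    G.toSignedColoredGraph.sgn y (i - 1) = 1 ∧ G.toSignedColoredGraph.sgn y i = -1 := by
  obtain ⟨v, w, a, b, c, hab, hbc, hv, h1, h2⟩ := h
  have hac := hab.trans hbc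
  refine ⟨?_, ?_, ?_, ?_⟩
  · rcases h1 with h1 | h1 <;> rw [G.sgn_left h1 hv] <;> simp [*]
  · rcases h1 with h1 | h1 <;> rw [G.sgn_right h1 hv] <;> simp [hac.le, hab.le]
  · rcases h2 with h2 | h2 <;> rw [G.sgn_left h2 hv] <;> simp [hac.le, hbc.le]
  · rcases h2 with h2 | h2 <;> rw [G.sgn_right h2 hv] <;> simp [*]

theorem axiom1 : G.toSignedColoredGraph.Axiom1 := by
  refine ⟨G.axiom0, fun i x h2 hi => ⟨?_, fun h => ?_⟩⟩
  · rintro ⟨y, hy⟩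
    rcases G.isOrientedPair_of_adj hy with h | h
    · obtain ⟨h1, h2, -, -⟩ := G.sgn_of_oriented h
      rw [h1, h2]
    · obtain ⟨-, -, h1, h2⟩ := G.sgn_of_oriented h
      rw [h1, h2, neg_neg]
  · obtain ⟨v, r, s, t, w, hx, hv⟩ := G.exists_split (x := x) h2 hi
    rw [G.sgn_left hx hv, G.sgn_right hx hv] at h
    have hnd := G.nodup x.1 x.2
    rw [hx] at hnd
    have hnd' : [r, s, t].Nodup := (List.nodup_append.1 (List.nodup_append.1 hnd).1).2.1
    have hrt : r ≠ t := by simp at hnd'; tauto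
    have hrs : r ≠ s := by simp at hnd'; tauto
    have hst : s ≠ t := by simp at hnd'; tauto
    -- The sign change makes the middle letter the largest or the smallest of the three; comparing
    -- the outer letters then decides between two patterns.
    have : ∃ a b c, a < b ∧ b < c ∧ ((x.1 = v ++ [b, a, c] ++ w ∨ x.1 = v ++ [c, a, b] ++ w) ∨
      (x.1 = v ++ [b, c, a] ++ w ∨ x.1 = v ++ [a, c, b] ++ w)) := by
      by_cases h1 : r ≤ s
      · have h3 : t < s := by
          by_contra h3
          rw [if_pos h1, if_pos (not_lt.1 h3)] at h
          exact absurd h (by decide)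
        rcases hrt.lt_or_gt with h4 | h4
        · exact ⟨r, t, s, h4, h3, Or.inr (Or.inr hx)⟩
        · exact ⟨t, r, s, h4, lt_of_le_of_ne h1 hrs, Or.inr (Or.inl hx)⟩
      · have h3 : s < t := by
          by_contra h3
          rw [if_neg h1, if_neg fun h4 => h3 (lt_of_le_of_ne h4 hst)] at h
          exact absurd h (by decide)
        rcases hrt.lt_or_gt with h4 | h4
        · exact ⟨s, r, t, not_le.1 h1, h4, Or.inl (Or.inl hx)⟩
        · exact ⟨s, t, r, h3, h4, Or.inl (Or.inr hx)⟩
    obtain ⟨a, b, c, hab, hbc, h⟩ := this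
    exact (G.existsUnique_adj_of_oriented hab hbc hv h).exists

theorem getElem?_of_oriented {i : ℕ} {x y : List (Fin N)} (h : IsOrientedPair i x y) {k : ℕ}
    (hk : k + 2 < i ∨ i < k) : x[k]? = y[k]? := by
  obtain ⟨v, w, a, b, c, -, -, hv, h1, h2⟩ := h
  -- Counted from 0, the window occupies the indices `i - 2, i - 1, i`.
  have key : ∀ r s t : Fin N, (v ++ [r, s, t] ++ w)[k]? =
      if k + 2 < i then v[k]? else w[k - (i + 1)]? := by
    intro r s t
    split_ifs with hk'
    · rw [List.append_assoc, List.getElem?_append_left (by omega)]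
    · rw [List.getElem?_append_right (by simp; omega)]
      simp only [List.length_append, List.length_cons, List.length_nil]
      congr 1
      omega
  rcases h1 with rfl | rfl <;> rcases h2 with rfl | rfl <;> rw [key, key]

theorem axiom2 : G.toSignedColoredGraph.Axiom2 := by
  have key : ∀ i x y, IsOrientedPair i x.1 y.1 →
      G.toSignedColoredGraph.sgn x (i - 1) = -G.toSignedColoredGraph.sgn y (i - 1) ∧
      G.toSignedColoredGraph.sgn x i = -G.toSignedColoredGraph.sgn y i ∧
      ∀ h, 1 ≤ h → h < n → (h + 2 < i ∨ i + 1 < h) →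
        G.toSignedColoredGraph.sgn x h = G.toSignedColoredGraph.sgn y h := by
    intro i x y h
    obtain ⟨h1, h2, h3, h4⟩ := G.sgn_of_oriented h
    refine ⟨by rw [h1, h3], by rw [h2, h4, neg_neg], fun k hk1 hk2 hk => ?_⟩
    exact G.sgn_congr (getElem?_of_oriented h (by omega)) (getElem?_of_oriented h (by omega))
  intro i x y h
  rcases G.isOrientedPair_of_adj h with h | h
  · exact key i x y h
  · obtain ⟨h1, h2, h3⟩ := key i y x h
    exact ⟨by rw [h1, neg_neg], by rw [h2, neg_neg], fun k hk1 hk2 hk => (h3 k hk1 hk2 hk).symm⟩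

end D0Graph

/-! ### Axiom 3 -/

namespace D0Graph

variable {N n : ℕ} (G : D0Graph N n)

theorem axiom3 : G.toSignedColoredGraph.Axiom3 := by
  -- Both outer letters weakly decrease from `x` to `y`. So an ascent of `y` just before the window
  -- is one of `x`, and an ascent of `x` just after the window is one of `y`; this fixes the
  -- direction of any sign change.
  have split : ∀ {i : ℕ} {x y : List (Fin N)}, IsOrientedPair i x y →
      ∃ v w x0 x1 x2 y0 y1 y2, v.length + 2 = i ∧ x = v ++ [x0, x1, x2] ++ w ∧
        y = v ++ [y0, y1, y2] ++ w ∧ y0 ≤ x0 ∧ y2 ≤ x2 := by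
    rintro i x y ⟨v, w, a, b, c, hab, hbc, hv, h1 | h1, h2 | h2⟩
    · exact ⟨v, w, b, a, c, b, c, a, hv, h1, h2, le_rfl, (hab.trans hbc).le⟩
    · exact ⟨v, w, b, a, c, a, c, b, hv, h1, h2, hab.le, hbc.le⟩
    · exact ⟨v, w, c, a, b, b, c, a, hv, h1, h2, hbc.le, hab.le⟩
    · exact ⟨v, w, c, a, b, a, c, b, hv, h1, h2, (hab.trans hbc).le, le_rfl⟩
  have left : ∀ {i x y}, IsOrientedPair i x.1 y.1 → 3 ≤ i →
      G.toSignedColoredGraph.sgn y (i - 2) = 1 → G.toSignedColoredGraph.sgn x (i - 2) = 1 := by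
    intro i x y h hi
    obtain ⟨v, w, x0, x1, x2, y0, y1, y2, hv, hx, hy, h0, -⟩ := split h
    obtain ⟨v, p, rfl⟩ : ∃ v' p, v = v' ++ [p] :=
      ⟨_, _, (List.dropLast_append_getLast (l := v) (by rintro rfl; simp at hv; omega)).symm⟩
    have hv' : v.length + 1 = i - 2 := by simp at hv; omega
    rw [G.sgn_eq (x := x) (p := v) (r := p) (s := x0) (q := x1 :: x2 :: w) (by simp [hx]) hv',
      G.sgn_eq (x := y) (p := v) (r := p) (s := y0) (q := y1 :: y2 :: w) (by simp [hy]) hv']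
    intro h
    by_cases hp : p ≤ y0
    · rw [if_pos (hp.trans h0)]
    · rw [if_neg hp] at h; exact absurd h (by decide)
  have right : ∀ {i x y}, IsOrientedPair i x.1 y.1 → i + 1 < n →
      G.toSignedColoredGraph.sgn x (i + 1) = 1 → G.toSignedColoredGraph.sgn y (i + 1) = 1 := by
    intro i x y h hi
    obtain ⟨v, w, x0, x1, x2, y0, y1, y2, hv, hx, hy, -, h0⟩ := split h
    have hlen := G.length_eq x.1 x.2
    rcases w with _ | ⟨q, w⟩
    · simp [hx] at hlen; omega
    rw [G.sgn_eq (x := x) (p := v ++ [x0, x1]) (r := x2) (s := q) (q := w) (by simp [hx])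
        (by simp; omega),
      G.sgn_eq (x := y) (p := v ++ [y0, y1]) (r := y2) (s := q) (q := w) (by simp [hy])
        (by simp; omega)]
    intro h
    by_cases hp : x2 ≤ q
    · rw [if_pos (h0.trans hp)]
    · rw [if_neg hp] at h; exact absurd h (by decide)
  have units : ∀ s t : ℤˣ, s = -t → (t = 1 → s = 1) → s = 1 ∧ t = -1 := by decide
  intro i x y h
  rcases G.isOrientedPair_of_adj h with h | h
  · obtain ⟨h1, h2, -, -⟩ := G.sgn_of_oriented h
    rw [h1, h2]
    refine ⟨fun hi hd => ?_, fun hi hd => ?_⟩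
    · rw [(units _ _ hd (left h hi)).1, neg_neg]
    · rw [← neg_eq_iff_eq_neg] at hd
      exact (units _ _ hd.symm (right h hi)).2
  · obtain ⟨-, -, h1, h2⟩ := G.sgn_of_oriented h
    rw [h1, h2]
    refine ⟨fun hi hd => ?_, fun hi hd => ?_⟩
    · rw [← neg_eq_iff_eq_neg] at hd
      exact (units _ _ hd.symm (left h hi)).2
    · rw [(units _ _ hd (right h hi)).1, neg_neg]

/-! ## The squares of a D₀ graph -/

/-- The length of `v` locates the window and the order of its letters names them, so a word belongs
to only one square for each `i`; edges stay in it and switch sides. -/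
theorem eq_of_adj_square {i : ℕ} {v w : List (Fin N)} {a b c : Fin N} (hab : a < b) (hbc : b < c)
    (hv : v.length + 2 = i) {x y : G.verts} (hxy : (G.edge i).Adj x y) :
    ((x.1 = v ++ [b, a, c] ++ w ∨ x.1 = v ++ [c, a, b] ++ w) →
      y.1 = v ++ [b, c, a] ++ w ∨ y.1 = v ++ [a, c, b] ++ w) ∧
    ((x.1 = v ++ [b, c, a] ++ w ∨ x.1 = v ++ [a, c, b] ++ w) →
      y.1 = v ++ [b, a, c] ++ w ∨ y.1 = v ++ [c, a, b] ++ w) := by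
  have inj : ∀ {v' w' : List (Fin N)} {r s t r' s' t' : Fin N}, v'.length + 2 = i →
      v ++ [r, s, t] ++ w = v' ++ [r', s', t'] ++ w' →
        v = v' ∧ w = w' ∧ r = r' ∧ s = s' ∧ t = t' := by
    intro v' w' r s t r' s' t' hv' h
    simp only [List.append_assoc] at h
    obtain ⟨h1, h2⟩ := List.append_inj h (by omega)
    simp only [List.cons_append, List.nil_append, List.cons.injEq] at h2
    tauto
  constructor
  all_goals
    intro hx
    rcases G.isOrientedPair_of_adj hxy with ⟨v', w', a', b', c', hab', hbc', hv', h1, h2⟩ |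
      ⟨v', w', a', b', c', hab', hbc', hv', h2, h1⟩ <;>
    rcases hx with hx | hx <;> rcases h1 with h1 | h1 <;> rw [hx] at h1 <;>
    obtain ⟨rfl, rfl, rfl, rfl, rfl⟩ := inj hv' h1 <;>
    first
      | exact h2
      | exact absurd (hab'.trans hbc') (by order)

/-- Here `q1, …, q4` select `bac`, `cab`, `bca`, `acb`, and `p1, …, p4` are the possible edges
`bac`–`bca`, `bac`–`acb`, `cab`–`bca`, `cab`–`acb`. -/
theorem ite_add_ite_of_matching {p1 p2 p3 p4 q1 q2 q3 q4 : Prop} [Decidable q1] [Decidable q2]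
    [Decidable q3] [Decidable q4] (r1 : p1 → (q1 ↔ q3)) (r2 : p2 → (q1 ↔ q4))
    (r3 : p3 → (q2 ↔ q3)) (r4 : p4 → (q2 ↔ q4)) (f1 : q1 → p1 ∨ p2) (f2 : q2 → p3 ∨ p4)
    (b1 : q3 → p1 ∨ p3) (b2 : q4 → p2 ∨ p4) (u1 : p1 → ¬ p2) (u2 : p3 → ¬ p4) (u3 : p1 → ¬ p3)
    (u4 : p2 → ¬ p4) :
    ((if q1 then 1 else 0) + (if q2 then 1 else 0) : ℕ) =
      (if q3 then 1 else 0) + (if q4 then 1 else 0) := by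
  by_cases h1 : p1 <;> by_cases h2 : p2 <;> by_cases h3 : p3 <;> by_cases h4 : p4 <;>
    simp_all [add_comm]

-- The edges restrict to a perfect matching between the two sides of the square within `S`, because
-- `S` is closed under `i`-edges.
open Classical in
theorem square_count {i : ℕ} {v w : List (Fin N)} {a b c : Fin N} (hab : a < b) (hbc : b < c)
    (hv : v.length + 2 = i) (S : G.verts → Prop)
    (hS : ∀ x y, S x → (G.edge i).Adj x y → S y) :
    ((if ∃ x : G.verts, x.1 = v ++ [b, a, c] ++ w ∧ S x then 1 else 0) +
      (if ∃ x : G.verts, x.1 = v ++ [c, a, b] ++ w ∧ S x then 1 else 0) : ℕ) =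
    (if ∃ x : G.verts, x.1 = v ++ [b, c, a] ++ w ∧ S x then 1 else 0) +
      (if ∃ x : G.verts, x.1 = v ++ [a, c, b] ++ w ∧ S x then 1 else 0) := by
  let R : List (Fin N) → List (Fin N) → Prop := fun X Y =>
    ∃ x y : G.verts, x.1 = X ∧ y.1 = Y ∧ (G.edge i).Adj x y
  have hR : ∀ X Y, R X Y →
      ((∃ x : G.verts, x.1 = X ∧ S x) ↔ ∃ x : G.verts, x.1 = Y ∧ S x) := by
    rintro X Y ⟨x, y, rfl, rfl, hxy⟩
    constructor
    · rintro ⟨x', hx', hs⟩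
      obtain rfl := Subtype.ext hx'
      exact ⟨y, rfl, hS _ _ hs hxy⟩
    · rintro ⟨x', hx', hs⟩
      obtain rfl := Subtype.ext hx'
      exact ⟨x, rfl, hS _ _ hs hxy.symm⟩
  have hR1 : ∀ X Y Y', Y ≠ Y' → R X Y → ¬ R X Y' := by
    rintro X Y Y' hne ⟨x, y, rfl, rfl, hxy⟩ ⟨x', y', hx, rfl, hxy'⟩
    obtain rfl := Subtype.ext hx
    exact hne (congrArg Subtype.val (G.axiom0 _ _ _ _ hxy hxy'))
  have hR2 : ∀ X X' Y, X ≠ X' → R X Y → ¬ R X' Y := by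
    rintro X Y Y' hne ⟨x, y, rfl, rfl, hxy⟩ ⟨x', y', rfl, hx, hxy'⟩
    obtain rfl := Subtype.ext hx
    exact hne (congrArg Subtype.val (G.axiom0 _ _ _ _ hxy.symm hxy'.symm))
  have hf : ∀ X, X = v ++ [b, a, c] ++ w ∨ X = v ++ [c, a, b] ++ w →
      (∃ x : G.verts, x.1 = X ∧ S x) →
      R X (v ++ [b, c, a] ++ w) ∨ R X (v ++ [a, c, b] ++ w) := by
    rintro X hX ⟨x, rfl, -⟩
    obtain ⟨y, hy⟩ := (G.existsUnique_adj_of_oriented hab hbc hv (Or.inl hX)).exists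
    rcases (G.eq_of_adj_square hab hbc hv hy).1 hX with h | h
    · exact Or.inl ⟨x, y, rfl, h, hy⟩
    · exact Or.inr ⟨x, y, rfl, h, hy⟩
  have hb : ∀ X, X = v ++ [b, c, a] ++ w ∨ X = v ++ [a, c, b] ++ w →
      (∃ x : G.verts, x.1 = X ∧ S x) →
      R (v ++ [b, a, c] ++ w) X ∨ R (v ++ [c, a, b] ++ w) X := by
    rintro X hX ⟨x, rfl, -⟩
    obtain ⟨y, hy⟩ := (G.existsUnique_adj_of_oriented hab hbc hv (Or.inr hX)).exists
    rcases (G.eq_of_adj_square hab hbc hv hy).2 hX with h | h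
    · exact Or.inl ⟨y, x, h, rfl, hy.symm⟩
    · exact Or.inr ⟨y, x, h, rfl, hy.symm⟩
  have hne1 : v ++ [b, a, c] ++ w ≠ v ++ [c, a, b] ++ w := by
    intro h; simp at h; exact hbc.ne h.1
  have hne2 : v ++ [b, c, a] ++ w ≠ v ++ [a, c, b] ++ w := by
    intro h; simp at h; exact hab.ne h.1.symm
  have f1 := hf _ (Or.inl rfl)
  have f2 := hf _ (Or.inr rfl)
  have b1 := hb _ (Or.inl rfl)
  have b2 := hb _ (Or.inr rfl)
  have r1 := hR (v ++ [b, a, c] ++ w) (v ++ [b, c, a] ++ w)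
  have r2 := hR (v ++ [b, a, c] ++ w) (v ++ [a, c, b] ++ w)
  have r3 := hR (v ++ [c, a, b] ++ w) (v ++ [b, c, a] ++ w)
  have r4 := hR (v ++ [c, a, b] ++ w) (v ++ [a, c, b] ++ w)
  have u1 := hR1 (v ++ [b, a, c] ++ w) _ _ hne2
  have u2 := hR1 (v ++ [c, a, b] ++ w) _ _ hne2
  have u3 := hR2 _ _ (v ++ [b, c, a] ++ w) hne1
  have u4 := hR2 _ _ (v ++ [a, c, b] ++ w) hne1
  exact ite_add_ite_of_matching r1 r2 r3 r4 f1 f2 b1 b2 u1 u2 u3 u4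

/-! ## Components of restrictions -/

theorem res_graph_adj {V : Type*} (H : SignedColoredGraph n V) {a d : ℕ} {x y : V} :
    (H.res a d).graph.Adj x y ↔ ∃ s, (2 ≤ s ∧ s < d) ∧ (H.edge (s + a - 1)).Adj x y := by
  rw [SignedColoredGraph.graph, SimpleGraph.iSup_adj]
  refine exists_congr fun s => ?_
  by_cases hs : 2 ≤ s ∧ s < d
  · simp [SignedColoredGraph.res, hs]
  · simp [SignedColoredGraph.res, hs]

theorem window_of_oriented {i a d : ℕ} (ha : a + 2 ≤ i) (hd : i + 1 ≤ a + d) {x y : List (Fin N)}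
    (h : IsOrientedPair i x y) :
    x.take a = y.take a ∧ x.drop (a + d) = y.drop (a + d) ∧
      ((x.drop a).take d).Perm ((y.drop a).take d) := by
  obtain ⟨v, w, b, c, e, -, -, hv, h1, h2⟩ := h
  have key : ∀ l : List (Fin N), l.length = 3 → (v ++ l ++ w).take a = v.take a ∧
      (v ++ l ++ w).drop (a + d) = w.drop (a + d - (i + 1)) ∧
      ((v ++ l ++ w).drop a).take d = v.drop a ++ l ++ w.take (a + d - (i + 1)) := by
    intro l hl
    refine ⟨?_, ?_, ?_⟩
    · rw [List.append_assoc, List.take_append_of_le_length (by omega)]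
    · rw [List.drop_append, List.drop_eq_nil_of_le (by simp; omega), List.nil_append]
      congr 1
      simp; omega
    · rw [List.append_assoc, List.drop_append_of_le_length (by omega), ← List.append_assoc,
        List.take_append, List.take_of_length_le (by simp; omega)]
      congr 2
      simp; omega
  have perm : ∃ l l' : List (Fin N), x = v ++ l ++ w ∧ y = v ++ l' ++ w ∧ l.length = 3 ∧
      l'.length = 3 ∧ l.Perm l' := by
    have p1 : [b, c, e].Perm [c, b, e] := List.Perm.swap _ _ _
    have p2 : [c, b, e].Perm [c, e, b] := (List.Perm.swap _ _ _).cons _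
    have p3 : [c, e, b].Perm [e, c, b] := List.Perm.swap _ _ _
    have p4 : [e, c, b].Perm [e, b, c] := (List.Perm.swap _ _ _).cons _
    have p5 : [b, c, e].Perm [b, e, c] := (List.Perm.swap _ _ _).cons _
    rcases h1 with rfl | rfl <;> rcases h2 with rfl | rfl
    · exact ⟨_, _, rfl, rfl, rfl, rfl, p2⟩
    · exact ⟨_, _, rfl, rfl, rfl, rfl, p1.symm.trans p5⟩
    · exact ⟨_, _, rfl, rfl, rfl, rfl, p4.symm.trans p3.symm⟩
    · exact ⟨_, _, rfl, rfl, rfl, rfl, (p4.symm.trans p3.symm).trans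
        (p2.symm.trans (p1.symm.trans p5))⟩
  obtain ⟨l, l', rfl, rfl, hl, hl', hp⟩ := perm
  obtain ⟨h1, h2, h3⟩ := key l hl
  obtain ⟨h1', h2', h3'⟩ := key l' hl'
  rw [h1, h2, h3, h1', h2', h3']
  exact ⟨rfl, rfl, (hp.append_left _).append_right _⟩

theorem window_of_reachable {a d : ℕ} {x y : G.verts}
    (h : (G.toSignedColoredGraph.res (a + 1) d).graph.Reachable x y) :
    x.1.take a = y.1.take a ∧ x.1.drop (a + d) = y.1.drop (a + d) ∧
      ((x.1.drop a).take d).Perm ((y.1.drop a).take d) := by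
  rw [SimpleGraph.reachable_iff_reflTransGen] at h
  induction h with
  | refl => exact ⟨rfl, rfl, List.Perm.refl _⟩
  | tail _ h ih =>
    obtain ⟨s, hs, h⟩ := (res_graph_adj _).1 h
    obtain ⟨i1, i2, i3⟩ := ih
    rcases G.isOrientedPair_of_adj h with h | h
    · obtain ⟨h1, h2, h3⟩ := window_of_oriented (a := a) (d := d) (by omega) (by omega) h
      exact ⟨i1.trans h1, i2.trans h2, i3.trans h3⟩
    · obtain ⟨h1, h2, h3⟩ := window_of_oriented (a := a) (d := d) (by omega) (by omega) h
      exact ⟨i1.trans h1.symm, i2.trans h2.symm, i3.trans h3.symm⟩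

end D0Graph

/-! ### Local Schur positivity -/

namespace D0Graph

variable {N n : ℕ} (G : D0Graph N n)

/-- A word without repeated letter on the letters listed by `ℓ` is the image of a permutation. -/
theorem exists_permWord {N d : ℕ} (ℓ : Fin d ↪o Fin N) {m : List (Fin N)} (hm : m.Nodup)
    (hd : m.length = d) (hℓ : ∀ r ∈ m, r ∈ Set.range ℓ) :
    ∃ p ∈ permWords d, m = p.map ℓ := by
  obtain ⟨p, rfl⟩ : ∃ p : List (Fin d), p.map ℓ = m := by
    have : m ∈ Set.range (List.map ℓ) := by
      rw [Set.range_list_map]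
      exact hℓ
    exact this
  refine ⟨p, ?_, rfl⟩
  rw [permWords, List.mem_permutations']
  have hp : p.Nodup := hm.of_map _
  refine (List.perm_ext_iff_of_nodup hp (List.nodup_finRange d)).2 fun c => ?_
  have hcard : p.toFinset = Finset.univ := by
    apply Finset.eq_univ_of_card
    rw [List.toFinset_card_of_nodup hp, Fintype.card_fin]
    simpa using hd
  rw [← List.mem_toFinset, hcard]
  simp

theorem descents_res {a d : ℕ} (ℓ : Fin d ↪o Fin N) {x : G.verts} {u t : List (Fin N)}
    {p : List (Fin d)} (hp : p.length = d) (hx : x.1 = u ++ p.map ℓ ++ t) (hu : u.length = a) :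
    fundamentalQSym d ((G.toSignedColoredGraph.res (a + 1) d).descents x) =
      qsymOfBits d (wordDescents p) := by
  rw [qsymOfBits]
  congr 1
  ext s
  have hs1 : (s : ℕ) < p.length := by omega
  have hs2 : (s : ℕ) + 1 < p.length := by omega
  have hsplit : p = p.take s ++ p[(s : ℕ)] :: p[(s : ℕ) + 1] :: p.drop (s + 2) := by
    conv_lhs => rw [← List.take_append_drop s p]
    rw [List.drop_eq_getElem_cons hs1, List.drop_eq_getElem_cons hs2]
  have hmap : p.map ℓ = (p.take s).map ℓ ++
      ℓ p[(s : ℕ)] :: ℓ p[(s : ℕ) + 1] :: (p.drop (s + 2)).map ℓ := by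
    conv_lhs => rw [hsplit]
    rw [List.map_append, List.map_cons, List.map_cons]
  have hsgn := G.sgn_eq (x := x) (p := u ++ (p.take s).map ℓ) (r := ℓ p[(s : ℕ)])
    (s := ℓ p[(s : ℕ) + 1]) (q := (p.drop (s + 2)).map ℓ ++ t) (k := s + (a + 1))
    (by simp only [hx, hmap, List.append_assoc, List.cons_append]) (by simp; omega)
  have h1 : s ∈ (G.toSignedColoredGraph.res (a + 1) d).descents x ↔
      G.toSignedColoredGraph.sgn x (s + (a + 1)) = -1 := Iff.rfl
  rw [h1, hsgn]
  have h2 : (wordDescents p)[(s : ℕ)]? = some (decide (p[(s : ℕ) + 1] < p[(s : ℕ)])) := by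
    simp [wordDescents, List.getElem?_zipWith, hs1, hs2]
  rw [Set.mem_ofPred_eq, h2]
  simp only [OrderEmbedding.le_iff_le, Option.some.injEq, decide_eq_true_eq]
  rw [← not_le]
  by_cases h : p[(s : ℕ)] ≤ p[(s : ℕ) + 1]
  · simp only [h, if_true, not_true, iff_false]; decide
  · simp [h]

theorem exists_componentGenFun_eq {a d : ℕ} (had : a + d ≤ n)
    (C : (G.toSignedColoredGraph.res (a + 1) d).graph.ConnectedComponent) :
    ∃ g : List (Fin d) → ℕ, IsBalanced g ∧
      (G.toSignedColoredGraph.res (a + 1) d).componentGenFun C =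
        ((permWords d).map fun p => g p • qsymOfBits d (wordDescents p)).sum := by
  classical
  obtain ⟨x₀, rfl⟩ := C.exists_rep
  set C := Quot.mk _ x₀ with hC
  have hx₀ := G.length_eq x₀.1 x₀.2
  set u := x₀.1.take a with hu
  set t := x₀.1.drop (a + d) with ht
  set m := (x₀.1.drop a).take d with hm
  have hul : u.length = a := by rw [hu, List.length_take]; omega
  have hml : m.length = d := by rw [hm, List.length_take, List.length_drop]; omega
  have hmnd : m.Nodup := (G.nodup _ x₀.2).sublist
    ((List.take_sublist _ _).trans (List.drop_sublist _ _))
  have hcard : m.toFinset.card = d := by rw [List.toFinset_card_of_nodup hmnd, hml]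
  set ℓ := m.toFinset.orderEmbOfFin hcard with hℓ
  have hrange : ∀ r, r ∈ Set.range ℓ ↔ r ∈ m := fun r => by
    rw [hℓ, Finset.range_orderEmbOfFin, Finset.mem_coe, List.mem_toFinset]
  have hmem : ∀ x : G.verts,
      (G.toSignedColoredGraph.res (a + 1) d).graph.connectedComponentMk x = C →
        ∃ p ∈ permWords d, x.1 = u ++ p.map ℓ ++ t := by
    intro x hx
    obtain ⟨h1, h2, h3⟩ := G.window_of_reachable (SimpleGraph.ConnectedComponent.exact hx)
    have hxl := G.length_eq x.1 x.2
    obtain ⟨p, hp, hpx⟩ := exists_permWord ℓ (m := (x.1.drop a).take d)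
      (h3.nodup_iff.2 hmnd) (by rw [h3.length_eq, ← hm, hml]) fun r hr =>
        (hrange r).2 (h3.mem_iff.1 hr)
    refine ⟨p, hp, ?_⟩
    rw [← hpx, hu, ← h1, ht, ← h2, List.append_assoc, ← List.drop_drop, List.take_append_drop,
      List.take_append_drop]
  have hlen : ∀ p ∈ permWords d, p.length = d := fun p hp => by
    rw [permWords, List.mem_permutations'] at hp
    rw [hp.length_eq, List.length_finRange]
  -- Outside the window all words of the component agree with `x₀`, so a vertex is encoded by the
  -- permutation `p` inside it; `ℓ` relabels the letters in an order-preserving way.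
  refine ⟨fun p => if ∃ x : G.verts, x.1 = u ++ p.map ℓ ++ t ∧
    (G.toSignedColoredGraph.res (a + 1) d).graph.connectedComponentMk x = C then 1 else 0, ?_, ?_⟩
  · intro v w b c e hbc hce
    have hword : ∀ r s q : Fin d, u ++ (v ++ [r, s, q] ++ w).map ℓ ++ t =
        (u ++ v.map ℓ) ++ [ℓ r, ℓ s, ℓ q] ++ (w.map ℓ ++ t) := by
      intro r s q; simp
    simp only [hword]
    by_cases hd : v.length + 3 + w.length = d
    · refine G.square_count (i := a + v.length + 2) (ℓ.strictMono hbc) (ℓ.strictMono hce)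
        (by simp; omega) _ fun x y hx hxy => ?_
      rw [← hx]
      refine (SimpleGraph.ConnectedComponent.sound (SimpleGraph.Adj.reachable ?_)).symm
      rw [res_graph_adj]
      refine ⟨v.length + 2, ⟨by omega, by omega⟩, ?_⟩
      rwa [show v.length + 2 + (a + 1) - 1 = a + v.length + 2 by omega]
    -- Balance is required for words of every length; for a length other than `d` all four values
    -- are 0.
    · have htl : t.length = n - (a + d) := by rw [ht, List.length_drop]; omega
      have hno : ∀ r s q : Fin N, ¬ ∃ x : G.verts,
          x.1 = (u ++ v.map ℓ) ++ [r, s, q] ++ (w.map ℓ ++ t) ∧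
          (G.toSignedColoredGraph.res (a + 1) d).graph.connectedComponentMk x = C := by
        rintro r s q ⟨x, hx, -⟩
        have hxl := G.length_eq x.1 x.2
        rw [hx] at hxl
        simp only [List.length_append, List.length_map, List.length_cons, List.length_nil] at hxl
        omega
      simp only [if_neg (hno _ _ _)]
  · have hnd : (permWords d).Nodup := List.nodup_permutations' (List.nodup_finRange d)
    rw [← List.sum_toFinset _ hnd]
    simp only [ite_smul, one_smul, zero_smul]
    rw [← Finset.sum_filter]
    unfold SignedColoredGraph.componentGenFun
    symm
    refine Finset.sum_bij (fun p hp => (Finset.mem_filter.1 hp).2.choose) ?_ ?_ ?_ ?_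
    · intro p hp
      rw [Finset.mem_filter]
      exact ⟨Finset.mem_univ _, (Finset.mem_filter.1 hp).2.choose_spec.2⟩
    · intro p hp p' hp' h
      have h1 := (Finset.mem_filter.1 hp).2.choose_spec.1
      have h2 := (Finset.mem_filter.1 hp').2.choose_spec.1
      rw [h] at h1
      have h3 := h1.symm.trans h2
      rw [List.append_left_inj, List.append_right_inj] at h3
      exact ℓ.injective.list_map h3
    · intro x hx
      obtain ⟨p, hp, hpx⟩ := hmem x (Finset.mem_filter.1 hx).2
      have hpf : ∃ x : G.verts, x.1 = u ++ p.map ℓ ++ t ∧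
        (G.toSignedColoredGraph.res (a + 1) d).graph.connectedComponentMk x = C :=
        ⟨x, hpx, (Finset.mem_filter.1 hx).2⟩
      refine ⟨p, Finset.mem_filter.2 ⟨List.mem_toFinset.2 hp, hpf⟩, ?_⟩
      exact Subtype.ext (hpf.choose_spec.1.trans hpx.symm)
    · intro p hp
      have h1 := (Finset.mem_filter.1 hp).2.choose_spec.1
      exact (G.descents_res ℓ (hlen p (List.mem_toFinset.1 (Finset.mem_filter.1 hp).1)) h1
        hul).symm

theorem lsp_four : G.toSignedColoredGraph.LSP 4 := by
  intro a ha had C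
  obtain ⟨a, rfl⟩ : ∃ k, a = k + 1 := ⟨a - 1, by omega⟩
  obtain ⟨g, hg, h⟩ := G.exists_componentGenFun_eq (by omega) C
  rw [h]
  exact hg.schurPositive_4

theorem lsp_five : G.toSignedColoredGraph.LSP 5 := by
  intro a ha had C
  obtain ⟨a, rfl⟩ : ∃ k, a = k + 1 := ⟨a - 1, by omega⟩
  obtain ⟨g, hg, h⟩ := G.exists_componentGenFun_eq (by omega) C
  rw [h]
  exact hg.schurPositive_5

end D0Graph

/-! ## Components that are paths with five vertices -/

namespace SignedColoredGraph

variable {n : ℕ} {V : Type*}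

/-- By axiom 0 an alternating path that cannot be extended at either end is a whole component. The
missing neighbors at the ends also exclude repeated vertices. -/
theorem componentGenFun_path [Fintype V] {H : SignedColoredGraph n V} (h0 : H.Axiom0) {a : ℕ}
    {x₁ x₂ x₃ x₄ x₅ : V} (h12 : (H.edge (a + 1)).Adj x₁ x₂) (h23 : (H.edge (a + 2)).Adj x₂ x₃)
    (h34 : (H.edge (a + 1)).Adj x₃ x₄) (h45 : (H.edge (a + 2)).Adj x₄ x₅)
    (n1 : ¬ H.AdmitsNeighbor (a + 2) x₁) (n5 : ¬ H.AdmitsNeighbor (a + 1) x₅) {y : V}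
    (hy : y ∈ [x₁, x₂, x₃, x₄, x₅]) :
    (H.res a 4).componentGenFun ((H.res a 4).graph.connectedComponentMk y) =
      ([x₁, x₂, x₃, x₄, x₅].map fun x => fundamentalQSym 4 ((H.res a 4).descents x)).sum := by
  classical
  have hadj : ∀ x z, (H.res a 4).graph.Adj x z ↔
      (H.edge (a + 1)).Adj x z ∨ (H.edge (a + 2)).Adj x z := by
    intro x z
    rw [D0Graph.res_graph_adj]
    constructor
    · rintro ⟨s, ⟨h2, h4⟩, h⟩
      obtain rfl | rfl : s = 2 ∨ s = 3 := by omega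
      · rw [show 2 + a - 1 = a + 1 by omega] at h; exact Or.inl h
      · rw [show 3 + a - 1 = a + 2 by omega] at h; exact Or.inr h
    · rintro (h | h)
      · exact ⟨2, by omega, by rwa [show 2 + a - 1 = a + 1 by omega]⟩
      · exact ⟨3, by omega, by rwa [show 3 + a - 1 = a + 2 by omega]⟩
  have hnd : [x₁, x₂, x₃, x₄, x₅].Nodup := by
    have e13 : x₁ ≠ x₃ := by rintro rfl; exact n1 ⟨_, h23.symm⟩
    have e14 : x₁ ≠ x₄ := by rintro rfl; exact n1 ⟨_, h45⟩
    have e15 : x₁ ≠ x₅ := by rintro rfl; exact n1 ⟨_, h45.symm⟩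
    have e24 : x₂ ≠ x₄ := by rintro rfl; exact e13 (h0 _ _ _ _ h12.symm h34.symm)
    have e25 : x₂ ≠ x₅ := by rintro rfl; exact n5 ⟨_, h12.symm⟩
    have e35 : x₃ ≠ x₅ := by rintro rfl; exact n5 ⟨_, h34⟩
    simp [h12.ne, h23.ne, h34.ne, h45.ne, e13, e14, e15, e24, e25, e35]
  have hclosed : ∀ x z, (H.res a 4).graph.Adj x z → x ∈ [x₁, x₂, x₃, x₄, x₅] →
      z ∈ [x₁, x₂, x₃, x₄, x₅] := by
    intro x z hxz hx
    simp only [List.mem_cons, List.not_mem_nil, or_false] at hx ⊢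
    rcases (hadj x z).1 hxz with h | h <;> rcases hx with rfl | rfl | rfl | rfl | rfl
    · exact Or.inr (Or.inl (h0 _ _ _ _ h h12))
    · exact Or.inl (h0 _ _ _ _ h h12.symm)
    · exact Or.inr (Or.inr (Or.inr (Or.inl (h0 _ _ _ _ h h34))))
    · exact Or.inr (Or.inr (Or.inl (h0 _ _ _ _ h h34.symm)))
    · exact absurd ⟨_, h⟩ n5
    · exact absurd ⟨_, h⟩ n1
    · exact Or.inr (Or.inr (Or.inl (h0 _ _ _ _ h h23)))
    · exact Or.inr (Or.inl (h0 _ _ _ _ h h23.symm))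
    · exact Or.inr (Or.inr (Or.inr (Or.inr (h0 _ _ _ _ h h45))))
    · exact Or.inr (Or.inr (Or.inr (Or.inl (h0 _ _ _ _ h h45.symm))))
  have r12 := ((hadj _ _).2 (Or.inl h12)).reachable
  have r13 := r12.trans ((hadj _ _).2 (Or.inr h23)).reachable
  have r14 := r13.trans ((hadj _ _).2 (Or.inl h34)).reachable
  have r15 := r14.trans ((hadj _ _).2 (Or.inr h45)).reachable
  have hreach : ∀ x ∈ [x₁, x₂, x₃, x₄, x₅], (H.res a 4).graph.Reachable x₁ x := by
    intro x hx
    simp only [List.mem_cons, List.not_mem_nil, or_false] at hx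
    rcases hx with rfl | rfl | rfl | rfl | rfl
    exacts [SimpleGraph.Reachable.refl _, r12, r13, r14, r15]
  rw [← List.sum_toFinset _ hnd]
  unfold componentGenFun
  refine Finset.sum_congr ?_ fun _ _ => rfl
  ext z
  rw [Finset.mem_filter, List.mem_toFinset, SimpleGraph.ConnectedComponent.eq]
  constructor
  · rintro ⟨-, hz⟩
    replace hz := hz.symm
    rw [SimpleGraph.reachable_iff_reflTransGen] at hz
    induction hz with
    | refl => exact hy
    | tail _ h ih => exact hclosed _ _ h ih
  · exact fun hz => ⟨Finset.mem_univ _, (hreach z hz).symm.trans (hreach y hy)⟩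

theorem descents_res_congr {H : SignedColoredGraph n V} {a a' : ℕ} {x x' : V}
    (h1 : H.sgn x a = H.sgn x' a') (h2 : H.sgn x (a + 1) = H.sgn x' (a' + 1))
    (h3 : H.sgn x (a + 2) = H.sgn x' (a' + 2)) :
    (H.res a 4).descents x = (H.res a' 4).descents x' := by
  ext s
  change H.sgn x (s + a) = -1 ↔ H.sgn x' (s + a') = -1
  fin_cases s
  · simp [h1]
  · simp [add_comm 1, h2]
  · simp [add_comm 2, h3]

end SignedColoredGraph

/-! ## The two components in axiom 4a -/

/-- `r` is the order of the letters and `ε = 1`, or `r` is the reverse order and `ε = -1`. -/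
def IsOrderSign {N : ℕ} (r : Fin N → Fin N → Prop) (ε : ℤˣ) : Prop :=
  (r = (· < ·) ∧ ε = 1) ∨ (r = (· > ·) ∧ ε = -1)

theorem IsOrderSign.trans {N : ℕ} {r : Fin N → Fin N → Prop} {ε : ℤˣ} (hr : IsOrderSign r ε)
    {a b c : Fin N} (h : r a b) (h' : r b c) : r a c := by
  rcases hr with ⟨rfl, -⟩ | ⟨rfl, -⟩
  · exact lt_trans h h'
  · exact lt_trans h' h

theorem IsOrderSign.ne {N : ℕ} {r : Fin N → Fin N → Prop} {ε : ℤˣ} (hr : IsOrderSign r ε)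
    {a b : Fin N} (h : r a b) : a ≠ b := by
  rcases hr with ⟨rfl, -⟩ | ⟨rfl, -⟩
  · exact ne_of_lt h
  · exact ne_of_gt h

namespace D0Graph

variable {N n : ℕ} (G : D0Graph N n) {r : Fin N → Fin N → Prop} {ε : ℤˣ}

theorem sgn_of_rel (hr : IsOrderSign r ε) {x : G.verts} {p q : List (Fin N)} {s t : Fin N}
    (hx : x.1 = p ++ s :: t :: q) {k : ℕ} (hk : p.length + 1 = k) :
    (r s t → G.toSignedColoredGraph.sgn x k = ε) ∧
      (r t s → G.toSignedColoredGraph.sgn x k = -ε) := by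
  rw [G.sgn_eq hx hk]
  rcases hr with ⟨rfl, rfl⟩ | ⟨rfl, rfl⟩
  · exact ⟨fun h => if_pos (le_of_lt h), fun h => if_neg (not_le.2 h)⟩
  · exact ⟨fun h => if_neg (not_le.2 h), fun h => by rw [if_pos (le_of_lt h), neg_neg]⟩

/-- Reversing the order maps each square to itself and exchanges its two sides. -/
theorem eq_of_adj_rel (hr : IsOrderSign r ε) {i : ℕ} {v w : List (Fin N)} {a b c : Fin N}
    (hab : r a b) (hbc : r b c) (hv : v.length + 2 = i) {x y : G.verts}
    (hxy : (G.edge i).Adj x y) :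
    ((x.1 = v ++ b :: a :: c :: w ∨ x.1 = v ++ c :: a :: b :: w) →
      y.1 = v ++ b :: c :: a :: w ∨ y.1 = v ++ a :: c :: b :: w) ∧
    ((x.1 = v ++ b :: c :: a :: w ∨ x.1 = v ++ a :: c :: b :: w) →
      y.1 = v ++ b :: a :: c :: w ∨ y.1 = v ++ c :: a :: b :: w) := by
  rcases hr with ⟨rfl, rfl⟩ | ⟨rfl, rfl⟩
  · have h := G.eq_of_adj_square (w := w) hab hbc hv hxy
    simpa only [List.append_assoc, List.cons_append, List.nil_append] using h
  · have h := G.eq_of_adj_square (w := w) hbc hab hv hxy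
    simpa only [List.append_assoc, List.cons_append, List.nil_append] using h.symm

/-- The two components in axiom 4a are paths with the same signatures. -/
theorem componentGenFun_eq_of_rotation (hr : IsOrderSign r ε) {l t : List (Fin N)}
    {a p b q c : Fin N} (hap : r a p) (hpb : r p b) (hbq : r b q) (hqc : r q c)
    {x y : G.verts} (hx : x.1 = l ++ p :: b :: a :: c :: q :: t)
    (hy : y.1 = l ++ p :: a :: c :: b :: q :: t) (hxy : (G.edge (l.length + 3)).Adj x y)
    {z z' : G.verts} (hz : z = x ∨ z = y) (hz' : z' = x ∨ z' = y) :
    (G.toSignedColoredGraph.res (l.length + 1) 4).componentGenFun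
        ((G.toSignedColoredGraph.res (l.length + 1) 4).graph.connectedComponentMk z) =
      (G.toSignedColoredGraph.res (l.length + 2) 4).componentGenFun
        ((G.toSignedColoredGraph.res (l.length + 2) 4).graph.connectedComponentMk z') := by
  have hlen : l.length + 5 ≤ n := by
    have := G.length_eq x.1 x.2
    simp [hx] at this
    omega
  have hab := hr.trans hap hpb
  have hbc := hr.trans hbq hqc
  have hpq := hr.trans hpb hbq
  have hpc := hr.trans hpb hbc
  have haq := hr.trans hab hbq
  have hac := hr.trans hab hbc
  -- the signs at the four positions of the block
  have sg1 : ∀ {x : G.verts} {s₁ s₂ : Fin N} {w}, x.1 = l ++ s₁ :: s₂ :: w →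
      (r s₁ s₂ → G.toSignedColoredGraph.sgn x (l.length + 1) = ε) ∧
      (r s₂ s₁ → G.toSignedColoredGraph.sgn x (l.length + 1) = -ε) := fun h =>
    G.sgn_of_rel hr h rfl
  have sg2 : ∀ {x : G.verts} {s₁ s₂ s₃ : Fin N} {w}, x.1 = l ++ s₁ :: s₂ :: s₃ :: w →
      (r s₂ s₃ → G.toSignedColoredGraph.sgn x (l.length + 2) = ε) ∧
      (r s₃ s₂ → G.toSignedColoredGraph.sgn x (l.length + 2) = -ε) := fun {_ s₁ _ _ _} h =>
    G.sgn_of_rel hr (p := l ++ [s₁]) (by simpa using h) (by simp)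
  have sg3 : ∀ {x : G.verts} {s₁ s₂ s₃ s₄ : Fin N} {w},
      x.1 = l ++ s₁ :: s₂ :: s₃ :: s₄ :: w →
      (r s₃ s₄ → G.toSignedColoredGraph.sgn x (l.length + 3) = ε) ∧
      (r s₄ s₃ → G.toSignedColoredGraph.sgn x (l.length + 3) = -ε) := fun {_ s₁ s₂ _ _ _} h =>
    G.sgn_of_rel hr (p := l ++ [s₁, s₂]) (by simpa using h) (by simp)
  have sg4 : ∀ {x : G.verts} {s₁ s₂ s₃ s₄ s₅ : Fin N} {w},
      x.1 = l ++ s₁ :: s₂ :: s₃ :: s₄ :: s₅ :: w →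
      (r s₄ s₅ → G.toSignedColoredGraph.sgn x (l.length + 4) = ε) ∧
      (r s₅ s₄ → G.toSignedColoredGraph.sgn x (l.length + 4) = -ε) :=
    fun {_ s₁ s₂ s₃ _ _ _} h =>
    G.sgn_of_rel hr (p := l ++ [s₁, s₂, s₃]) (by simpa using h) (by simp)
  -- the edges of the three colors
  have nb2 : ∀ {x y : G.verts} {a b c : Fin N} {w}, r a b → r b c →
      (G.edge (l.length + 2)).Adj x y →
      ((x.1 = l ++ b :: a :: c :: w ∨ x.1 = l ++ c :: a :: b :: w) →
        y.1 = l ++ b :: c :: a :: w ∨ y.1 = l ++ a :: c :: b :: w) ∧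
      ((x.1 = l ++ b :: c :: a :: w ∨ x.1 = l ++ a :: c :: b :: w) →
        y.1 = l ++ b :: a :: c :: w ∨ y.1 = l ++ c :: a :: b :: w) := fun h1 h2 h =>
    G.eq_of_adj_rel hr h1 h2 rfl h
  have nb3 : ∀ {x y : G.verts} {s a b c : Fin N} {w}, r a b → r b c →
      (G.edge (l.length + 3)).Adj x y →
      ((x.1 = l ++ s :: b :: a :: c :: w ∨ x.1 = l ++ s :: c :: a :: b :: w) →
        y.1 = l ++ s :: b :: c :: a :: w ∨ y.1 = l ++ s :: a :: c :: b :: w) ∧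
      ((x.1 = l ++ s :: b :: c :: a :: w ∨ x.1 = l ++ s :: a :: c :: b :: w) →
        y.1 = l ++ s :: b :: a :: c :: w ∨ y.1 = l ++ s :: c :: a :: b :: w) :=
    fun {_ _ s _ _ _ w} h1 h2 h => by
      simpa using G.eq_of_adj_rel hr (v := l ++ [s]) (w := w) h1 h2 (by simp) h
  have nb4 : ∀ {x y : G.verts} {s s' a b c : Fin N} {w}, r a b → r b c →
      (G.edge (l.length + 4)).Adj x y →
      ((x.1 = l ++ s :: s' :: b :: a :: c :: w ∨ x.1 = l ++ s :: s' :: c :: a :: b :: w) →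
        y.1 = l ++ s :: s' :: b :: c :: a :: w ∨ y.1 = l ++ s :: s' :: a :: c :: b :: w) ∧
      ((x.1 = l ++ s :: s' :: b :: c :: a :: w ∨ x.1 = l ++ s :: s' :: a :: c :: b :: w) →
        y.1 = l ++ s :: s' :: b :: a :: c :: w ∨ y.1 = l ++ s :: s' :: c :: a :: b :: w) :=
    fun {_ _ s s' _ _ _ w} h1 h2 h => by
      simpa using G.eq_of_adj_rel hr (v := l ++ [s, s']) (w := w) h1 h2 (by simp) h
  have flip : ∀ {k : ℕ} {x y : G.verts}, (G.edge (k + 1)).Adj x y →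
      G.toSignedColoredGraph.sgn y k = -G.toSignedColoredGraph.sgn x k ∧
      G.toSignedColoredGraph.sgn y (k + 1) = -G.toSignedColoredGraph.sgn x (k + 1) := fun h =>
    ⟨(G.axiom2 _ _ _ h.symm).1, (G.axiom2 _ _ _ h.symm).2.1⟩
  have admits : ∀ {k : ℕ} {x : G.verts}, 1 ≤ k → k + 1 < n →
      G.toSignedColoredGraph.sgn x k = -G.toSignedColoredGraph.sgn x (k + 1) →
      ∃ y, (G.edge (k + 1)).Adj x y := fun h1 h2 h =>
    (G.axiom1.2 _ _ (by omega) h2).2 h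
  have notAdmits : ∀ {k : ℕ} {x : G.verts}, 1 ≤ k → k + 1 < n →
      G.toSignedColoredGraph.sgn x k = ε → G.toSignedColoredGraph.sgn x (k + 1) = ε →
      ¬ G.toSignedColoredGraph.AdmitsNeighbor (k + 1) x := fun {k x} h1 h2 h h' ha => by
    have := (G.axiom1.2 _ _ (by omega) h2).1 ha
    rw [Nat.add_sub_cancel, h, h'] at this
    exact (by decide : ∀ s : ℤˣ, s ≠ -s) _ this
  -- The signs of `x` are `ε, -ε, ε, -ε` and those of `y` are opposite, so `x` in either window has
  -- the signature of `y` in the other.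
  have X1 := (sg1 hx).1 hpb
  have X2 := (sg2 hx).2 hab
  have X3 := (sg3 hx).1 hac
  have X4 := (sg4 hx).2 hqc
  have Y1 := (sg1 hy).2 hap
  have Y2 := (sg2 hy).1 hac
  have Y3 := (sg3 hy).2 hbc
  have Y4 := (sg4 hy).1 hbq
  -- the left component
  obtain ⟨x1, e1⟩ := admits (x := x) (k := l.length + 1) (by omega) (by omega)
    (by rw [X1, X2, neg_neg])
  obtain ⟨x4, e4⟩ := admits (x := y) (k := l.length + 1) (by omega) (by omega)
    (by rw [Y1, Y2])
  have A3 : G.toSignedColoredGraph.sgn x1 (l.length + 3) = ε := by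
    rcases (nb2 hap hpb e1).2 (Or.inl hx) with h | h
    · exact (sg3 h).1 hbc
    · exact (sg3 h).1 hpc
  have B := (nb2 hap hpc e4).1 (Or.inl hy)
  have B3 : G.toSignedColoredGraph.sgn x4 (l.length + 3) = ε := by
    rcases B with h | h
    · exact (sg3 h).1 hab
    · exact (sg3 h).1 hpb
  obtain ⟨A1, A2⟩ := flip e1
  obtain ⟨B1, B2⟩ := flip e4
  rw [X1] at A1
  rw [X2, neg_neg] at A2
  rw [Y1, neg_neg] at B1
  rw [Y2] at B2
  obtain ⟨x5, e5⟩ := admits (x := x4) (k := l.length + 2) (by omega) (by omega)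
    (by rw [B2, B3])
  obtain ⟨C2, C3⟩ := flip e5
  rw [B2, neg_neg] at C2
  rw [B3] at C3
  have C1 : G.toSignedColoredGraph.sgn x5 (l.length + 1) = ε := by
    rcases B with hB | hB
    · rcases (nb3 hab hbc e5).1 (Or.inr hB) with h | h
      · exact (sg1 h).1 hpb
      -- Otherwise the edge from `x4` would end at `y`, whose only neighbor of this color is `x`;
      -- but `x4` and `x` differ.
      · exfalso
        obtain rfl : x5 = y := Subtype.ext (h.trans hy.symm)
        have := congrArg Subtype.val (G.axiom0 _ _ _ _ e5.symm hxy.symm)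
        rw [hB, hx] at this
        simp only [List.append_cancel_left_eq, List.cons.injEq] at this
        exact hr.ne hbc this.2.1.symm
    · rcases (nb3 hpb hbc e5).1 (Or.inr hB) with h | h
      · exact (sg1 h).1 hab
      · exact (sg1 h).1 hap
  -- the right component
  obtain ⟨z5, f5⟩ := admits (x := y) (k := l.length + 3) (by omega) (by omega)
    (by rw [Y3, Y4])
  obtain ⟨z2, f2⟩ := admits (x := x) (k := l.length + 3) (by omega) (by omega)
    (by rw [X3, X4, neg_neg])
  have D2 : G.toSignedColoredGraph.sgn z5 (l.length + 2) = ε := by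
    rcases (nb4 hbq hqc f5).1 (Or.inr hy) with h | h
    · exact (sg2 h).1 haq
    · exact (sg2 h).1 hab
  have E := (nb4 haq hqc f2).2 (Or.inr hx)
  have E2 : G.toSignedColoredGraph.sgn z2 (l.length + 2) = ε := by
    rcases E with h | h
    · exact (sg2 h).1 hbq
    · exact (sg2 h).1 hbc
  obtain ⟨D3, D4⟩ := flip f5
  obtain ⟨E3, E4⟩ := flip f2
  rw [Y3, neg_neg] at D3
  rw [Y4] at D4
  rw [X3] at E3
  rw [X4, neg_neg] at E4
  obtain ⟨z1, f1⟩ := admits (x := z2) (k := l.length + 2) (by omega) (by omega)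
    (by rw [E2, E3, neg_neg])
  obtain ⟨F2, F3⟩ := flip f1
  rw [E2] at F2
  rw [E3, neg_neg] at F3
  have F4 : G.toSignedColoredGraph.sgn z1 (l.length + 4) = ε := by
    rcases E with hE | hE
    · rcases (nb3 hab hbq f1).2 (Or.inl hE) with h | h
      · exact (sg4 h).1 hqc
      · exact (sg4 h).1 hbc
    · rcases (nb3 hab hbc f1).2 (Or.inl hE) with h | h
      -- The mirror case: `z1 = x` would force `z2 = y`.
      · exfalso
        obtain rfl : z1 = x := Subtype.ext (h.trans hx.symm)
        have := congrArg Subtype.val (G.axiom0 _ _ _ _ f1.symm hxy)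
        rw [hE, hy] at this
        simp only [List.append_cancel_left_eq, List.cons.injEq] at this
        exact hr.ne hab this.2.1.symm
      · exact (sg4 h).1 hbq
  -- The paths are `x1, x, y, x4, x5` and `z1, z2, x, y, z5`. Along both, the signatures are `(-ε,
  -- ε, ε)`, `(ε, -ε, ε)`, `(-ε, ε, -ε)`, `(ε, -ε, ε)`, `(ε, ε, -ε)`.
  rw [SignedColoredGraph.componentGenFun_path G.axiom0 (a := l.length + 1) e1.symm hxy e4 e5
      (notAdmits (by omega) (by omega) A2 A3) (notAdmits (by omega) (by omega) C1 C2)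
      (by rcases hz with rfl | rfl <;> simp),
    SignedColoredGraph.componentGenFun_path G.axiom0 (a := l.length + 2) f1.symm f2.symm hxy f5
      (notAdmits (by omega) (by omega) F3 F4) (notAdmits (by omega) (by omega) D2 D3)
      (by rcases hz' with rfl | rfl <;> simp)]
  have cg : ∀ {u u' : G.verts}, G.toSignedColoredGraph.sgn u (l.length + 1) =
      G.toSignedColoredGraph.sgn u' (l.length + 2) →
      G.toSignedColoredGraph.sgn u (l.length + 2) =
        G.toSignedColoredGraph.sgn u' (l.length + 3) →
      G.toSignedColoredGraph.sgn u (l.length + 3) =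
        G.toSignedColoredGraph.sgn u' (l.length + 4) →
      (G.toSignedColoredGraph.res (l.length + 1) 4).descents u =
        (G.toSignedColoredGraph.res (l.length + 2) 4).descents u' := fun h1 h2 h3 =>
    SignedColoredGraph.descents_res_congr h1 h2 h3
  simp only [List.map_cons, List.map_nil]
  rw [cg (A1.trans F2.symm) (A2.trans F3.symm) (A3.trans F4.symm),
    cg (X1.trans E2.symm) (X2.trans E3.symm) (X3.trans E4.symm),
    cg (Y1.trans X2.symm) (Y2.trans X3.symm) (Y3.trans X4.symm),
    cg (B1.trans Y2.symm) (B2.trans Y3.symm) (B3.trans Y4.symm),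
    cg (C1.trans D2.symm) (C2.trans D3.symm) (C3.trans D4.symm)]

theorem axiom4a : G.toSignedColoredGraph.Axiom4a := by
  have key : ∀ i x y, 4 ≤ i → i < n → IsOrientedPair (i - 1) x.1 y.1 →
      (G.edge (i - 1)).Adj x y →
      G.toSignedColoredGraph.sgn x (i - 3) ≠ G.toSignedColoredGraph.sgn y (i - 3) →
      G.toSignedColoredGraph.sgn x i ≠ G.toSignedColoredGraph.sgn y i →
      ∀ z, z = x ∨ z = y →
        (G.toSignedColoredGraph.res (i - 3) 4).componentGenFun
          ((G.toSignedColoredGraph.res (i - 3) 4).graph.connectedComponentMk z) =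
        (G.toSignedColoredGraph.res (i - 2) 4).componentGenFun
          ((G.toSignedColoredGraph.res (i - 2) 4).graph.connectedComponentMk z) := by
    intro i x y h4 hi ho hxy hl hr z hz
    obtain ⟨v, w, a, b, c, hab, hbc, hv, h1, h2⟩ := ho
    obtain ⟨l, p, rfl⟩ : ∃ v' p, v = v' ++ [p] :=
      ⟨_, _, (List.dropLast_append_getLast (l := v) (by rintro rfl; simp at hv; omega)).symm⟩
    obtain rfl : i = l.length + 4 := by simp at hv; omega
    obtain ⟨q, t, rfl⟩ : ∃ q t, w = q :: t := by
      rcases w with _ | ⟨q, t⟩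
      · have := G.length_eq x.1 x.2
        rcases h1 with h1 | h1 <;> simp [h1] at this <;> omega
      · exact ⟨q, t, rfl⟩
    have hnd := G.nodup x.1 x.2
    have hp : p ≠ a ∧ p ≠ b ∧ p ≠ c ∧ q ≠ a ∧ q ≠ b ∧ q ≠ c := by
      rcases h1 with h1 | h1 <;> rw [h1] at hnd <;>
        simp [List.nodup_append] at hnd <;> grind
    obtain ⟨pa, pb, pc, qa, qb, qc⟩ := hp
    have sgl : ∀ {x : G.verts} {r s u : Fin N}, x.1 = l ++ [p] ++ [r, s, u] ++ q :: t →
        G.toSignedColoredGraph.sgn x (l.length + 4 - 3) = if p ≤ r then 1 else -1 :=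
      fun {x r s u} h => G.sgn_eq (p := l) (q := s :: u :: q :: t) (by simp [h]) (by omega)
    have sgr : ∀ {x : G.verts} {r s u : Fin N}, x.1 = l ++ [p] ++ [r, s, u] ++ q :: t →
        G.toSignedColoredGraph.sgn x (l.length + 4) = if u ≤ q then 1 else -1 :=
      fun {x r s u} h => G.sgn_eq (p := l ++ [p, r, s]) (q := t) (by simp [h]) (by simp)
    rcases h1 with h1 | h1 <;> rcases h2 with h2 | h2
    -- A Knuth pair with a common first letter: the sign to the left cannot change.
    · rw [sgl h1, sgl h2] at hl; exact absurd rfl hl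
    -- A rotation pair: the changed signs place `p` between `a` and `b`, and `q` between `b` and
    -- `c`.
    · rw [sgl h1, sgl h2] at hl
      rw [sgr h1, sgr h2] at hr
      exact G.componentGenFun_eq_of_rotation (Or.inl ⟨rfl, rfl⟩) (l := l) (t := t) (a := a)
        (p := p) (b := b) (q := q) (c := c) (by grind) (by grind) (by grind) (by grind)
        (by simp [h1]) (by simp [h2]) hxy hz hz
    -- The other rotation pair is the first one for the reversed order, with `a` and `c` as well as
    -- `x` and `y` exchanged.
    · rw [sgl h1, sgl h2] at hl
      rw [sgr h1, sgr h2] at hr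
      exact G.componentGenFun_eq_of_rotation (Or.inr ⟨rfl, rfl⟩) (l := l) (t := t) (a := c)
        (p := p) (b := b) (q := q) (c := a) (by grind) (by grind) (by grind) (by grind)
        (by simp [h2]) (by simp [h1]) hxy.symm hz.symm hz.symm
    · rw [sgr h1, sgr h2] at hr; exact absurd rfl hr
  intro i x y h4 hi hxy _ hl hr
  rcases G.isOrientedPair_of_adj hxy with h | h
  · exact key i x y h4 hi h hxy hl hr x (Or.inl rfl)
  · exact key i y x h4 hi h hxy.symm hl.symm hr.symm x (Or.inr rfl)

end D0Graph

theorem theoremt (N n : ℕ) (G : D0Graph N n) :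
    (G.toSignedColoredGraph.Axiom1 ∧ G.toSignedColoredGraph.Axiom2 ∧
      G.toSignedColoredGraph.Axiom3 ∧ G.toSignedColoredGraph.Axiom4a ∧
      G.toSignedColoredGraph.LSP 4 ∧ G.toSignedColoredGraph.LSP 5) ∧
    (G.toSignedColoredGraph.IsDGraph ↔
      G.toSignedColoredGraph.Axiom4b ∧ G.toSignedColoredGraph.Axiom5) :=
  ⟨⟨G.axiom1, G.axiom2, G.axiom3, G.axiom4a, G.lsp_four, G.lsp_five⟩,
    fun h => ⟨h.2.2.2.2.1, h.2.2.2.2.2.1⟩,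
    fun h => ⟨G.axiom1, G.axiom2, G.axiom3, G.axiom4a, h.1, h.2, G.lsp_four, G.lsp_five⟩⟩
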